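/- **Setting.** Let an oriented closed interval be embedded in $S^2$ (concretely, a meridian parametrized by $[0,1]$ and running from one pole to the other), with initial endpoint the leg $l$ and final endpoint the head $h$. A *spherical linear chord diagram of order one* consists of two distinct interior points $p<q$ of the interval together with a chord: a smooth immersed arc in $S^2\setminus\{l,h\}$ from $p$ to $q$, in general position with respect to itself (finitely many self-crossings, all transverse double points lying off the interval) and transverse to the interval; all crossings are flat (no over/under information). Diagrams are considered up to orientation-preserving diffeomorphisms of the interval (which carry the ends of the chord along) and up to flat isotopy of the chord, that is, regular homotopy through immersed arcs in $S^2\setminus\{l,h\}$ with the ends kept fixed; the arc may pass through itself and through the interval, and its tangent directions at the ends may vary. Let $A_1^l$ be the set of equivalence classes. *Concatenation.* Given classes $x,y\in A_1^l$, choose representatives on the same interval such that both ends of the chord of $x$ precede both ends of the chord of $y$, and join the destination of the first chord to the start of the second by an arc contained in a disc neighbourhood in $S^2\setminus\{l,h\}$ of the part of the interval between these two points, so that the resulting immersed curve meets the interval along this connecting arc only at the two points joined, transversally. The resulting curve, from the start of the first chord to the destination of the second, is a chord that represents $x\cdot y$. Let $a\in A_1^l$ be the class of the chord that, followed from the end closer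 to $l$ to the end closer to $h$, goes exactly once around $l$, counterclockwise. **Proposition.** Any two classes in $A_1^l$ have representatives that can be concatenated, the class of the result depends only on the two classes, and $A_1^l$ is a group under this multiplication. For every $C\in A_1^l$ there is a unique $w\in\mathbb Z$ with $C=a^w$. In particular, $A_1^l$ is an infinite cyclic group. -/

import Mathlib

open scoped ContDiff

namespace Knotoid

noncomputable section

/-- Euclidean three-space; the sphere `S²` is its unit sphere, and all arcs below lie on it. -/
abbrev E3 : Type := EuclideanSpace ℝ (Fin 3)

/-- The closed unit interval, as a set of reals. -/
abbrev I01 : Set ℝ := Set.Icc (0 : ℝ) 1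

/-- The point of `S²` at polar angle `θ` (measured from the north pole) and longitude `ψ`.
Seen from outside the sphere, increasing `ψ` is the counterclockwise direction around the
north pole. -/
def sph (θ ψ : ℝ) : E3 := !₂[Real.sin θ * Real.cos ψ, Real.sin θ * Real.sin ψ, Real.cos θ]

/-- The oriented closed interval of a linear chord diagram, laid down in `S²` as the meridian of
longitude zero, parametrized by `[0,1]` from the north pole to the south pole. -/
def interval (x : ℝ) : E3 := sph (Real.pi * x) 0

/-- The leg `l`: the initial endpoint of the interval. -/
def leg : E3 := interval 0

/-- The head `h`: the final endpoint of the interval. -/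
def head : E3 := interval 1

/-- `c`, restricted to `[0,1]`, is a smooth immersed arc in `S² ∖ {l, h}`. -/
structure IsImmersedArc (c : ℝ → E3) : Prop where
  smooth : ContDiffOn ℝ ∞ c I01
  mem_sphere : ∀ t ∈ I01, c t ∈ Metric.sphere (0 : E3) 1
  ne_leg : ∀ t ∈ I01, c t ≠ leg
  ne_head : ∀ t ∈ I01, c t ≠ head
  immersed : ∀ t ∈ I01, derivWithin c I01 t ≠ 0

/-- `c` is in general position, with respect to itself and to the interval: its self-crossings
are transverse double points that do not lie on the interval, and all its intersections with the
interval (those at the ends of `c` included) are transverse. On the sphere, two tangent vectors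
at a point span the tangent plane iff they are linearly independent. -/
structure IsGeneric (c : ℝ → E3) : Prop where
  self_transverse : ∀ t ∈ I01, ∀ u ∈ I01, t ≠ u → c t = c u →
    LinearIndependent ℝ ![derivWithin c I01 t, derivWithin c I01 u]
  no_triple : ∀ t ∈ I01, ∀ u ∈ I01, ∀ v ∈ I01, c t = c u → c u = c v → t = u ∨ u = v ∨ t = v
  double_off_interval : ∀ t ∈ I01, ∀ u ∈ I01, t ≠ u → c t = c u → c t ∉ interval '' I01
  interval_transverse : ∀ t ∈ I01, ∀ x ∈ I01, c t = interval x →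
    LinearIndependent ℝ ![derivWithin c I01 t, deriv interval x]

/-- A spherical linear chord diagram of order one (before passing to equivalence classes): the
interval in `S²`, two distinct points on it, the one closer to the leg being the start and the
other the destination, and a chord, that is, an immersed arc in general position in
`S² ∖ {l, h}` which runs from the start to the destination. All crossings are flat, so no
over/under data are recorded. -/
structure LinearChordDiagram where
  start : ℝ
  dest : ℝ
  start_pos : 0 < start
  start_lt_dest : start < dest
  dest_lt_one : dest < 1
  chord : ℝ → E3
  isImmersedArc : IsImmersedArc chord
  isGeneric : IsGeneric chord
  chord_zero : chord 0 = interval start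
  chord_one : chord 1 = interval dest

/-- An orientation preserving diffeomorphism of `[0,1]`. -/
structure IsIntervalDiffeo (f : ℝ → ℝ) : Prop where
  smooth : ContDiffOn ℝ ∞ f I01
  map_zero : f 0 = 0
  map_one : f 1 = 1
  deriv_pos : ∀ x ∈ I01, 0 < derivWithin f I01 x

/-- Flat isotopy of linear chord diagrams. The interval undergoes a continuous family `φ` of
orientation preserving diffeomorphisms starting at the identity (every orientation preserving
diffeomorphism of `[0,1]` is the end of such a family) which carries the two marked points along;
meanwhile the chord moves by a regular homotopy `H` in `S² ∖ {l, h}` (through immersed arcs, with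
velocity vectors varying continuously), its ends remaining attached to the two marked points.
For `φ s = id` this is an isotopy of the immersed arc that fixes the ends. The chord may pass
through itself and through the interval (everything is flat), but not through `l` or `h`. -/
def FlatIsotopic (D D' : LinearChordDiagram) : Prop :=
  ∃ (φ : ℝ → ℝ → ℝ) (H : ℝ → ℝ → E3),
    ContinuousOn (fun z : ℝ × ℝ => φ z.1 z.2) (I01 ×ˢ I01) ∧
    (∀ s ∈ I01, IsIntervalDiffeo (φ s)) ∧
    (∀ x ∈ I01, φ 0 x = x) ∧
    φ 1 D.start = D'.start ∧ φ 1 D.dest = D'.dest ∧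
    ContinuousOn (fun z : ℝ × ℝ => H z.1 z.2) (I01 ×ˢ I01) ∧
    ContinuousOn (fun z : ℝ × ℝ => derivWithin (H z.1) I01 z.2) (I01 ×ˢ I01) ∧
    (∀ s ∈ I01, IsImmersedArc (H s)) ∧
    (∀ s ∈ I01, H s 0 = interval (φ s D.start) ∧ H s 1 = interval (φ s D.dest)) ∧
    Set.EqOn (H 0) D.chord I01 ∧ Set.EqOn (H 1) D'.chord I01

/-- The set `A₁ˡ` of spherical linear chord diagrams of order one, considered up to (the
equivalence relation generated by) orientation preserving diffeomorphisms of the interval and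
flat isotopies of the chord. -/
def A1l : Type := Quot FlatIsotopic

/-- The element of `A₁ˡ` represented by a diagram. -/
def LinearChordDiagram.toA1l (D : LinearChordDiagram) : A1l := Quot.mk FlatIsotopic D

/-- `D` is a concatenation of `X` and `Y`: on the common interval both ends of the chord of `X`
come before those of the chord of `Y`; the chord of `D` first runs along the chord of `X`, then
along a connecting arc from the destination of `X` to the start of `Y`, and then along the chord
of `Y`. The connecting arc stays in the open hemisphere with positive first coordinate, which is
a disc neighbourhood in `S² ∖ {l, h}` of the open interval, and meets the interval only at its
two ends (where the chord of `D` is transverse to the interval, as `D` is in general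
position). -/
def IsConcatenation (X Y D : LinearChordDiagram) : Prop :=
  X.dest < Y.start ∧ D.start = X.start ∧ D.dest = Y.dest ∧
  ∃ t₁ t₂ : ℝ, 0 < t₁ ∧ t₁ < t₂ ∧ t₂ < 1 ∧
    (∀ t ∈ Set.Icc 0 t₁, D.chord t = X.chord (t / t₁)) ∧
    (∀ t ∈ Set.Ioo t₁ t₂, 0 < D.chord t 0 ∧ D.chord t ∉ interval '' I01) ∧
    (∀ t ∈ Set.Icc t₂ 1, D.chord t = Y.chord ((t - t₂) / (1 - t₂)))

/-- The arc from `interval (1/3)` to `interval (2/3)` which moves steadily away from the leg while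
going exactly once counterclockwise around it. -/
def windingArc (t : ℝ) : E3 := sph (Real.pi * ((1 + t) / 3)) (2 * Real.pi * t)

theorem sin_polar_pos {t : ℝ} (ht : t ∈ I01) : 0 < Real.sin (Real.pi * ((1 + t) / 3)) := by
  have hpi := Real.pi_pos
  apply Real.sin_pos_of_pos_of_lt_pi
  · have := ht.1
    positivity
  · have := ht.2
    nlinarith

theorem windingArc_injOn : Set.InjOn windingArc I01 := by
  intro t ht u hu h
  have hpi := Real.pi_pos
  have h2 : Real.cos (Real.pi * ((1 + t) / 3)) = Real.cos (Real.pi * ((1 + u) / 3)) := by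
    have := congrArg (fun v : E3 => v 2) h
    simpa [windingArc, sph] using this
  have h3 := Real.injOn_cos (x₁ := Real.pi * ((1 + t) / 3)) (x₂ := Real.pi * ((1 + u) / 3))
    ⟨by have := ht.1; positivity, by have := ht.2; nlinarith⟩
    ⟨by have := hu.1; positivity, by have := hu.2; nlinarith⟩ h2
  have h4 := mul_left_cancel₀ hpi.ne' h3
  linarith

theorem hasDerivAt_sph {f g : ℝ → ℝ} {f' g' t : ℝ} (hf : HasDerivAt f f' t)
    (hg : HasDerivAt g g' t) :
    HasDerivAt (fun t => sph (f t) (g t))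
      (!₂[Real.cos (f t) * f' * Real.cos (g t) + Real.sin (f t) * (-Real.sin (g t) * g'),
        Real.cos (f t) * f' * Real.sin (g t) + Real.sin (f t) * (Real.cos (g t) * g'),
        -Real.sin (f t) * f'] : E3) t := by
  rw [← hasDerivWithinAt_univ, hasDerivWithinAt_iff_hasFDerivWithinAt,
    hasFDerivWithinAt_euclidean]
  intro i
  rw [hasFDerivWithinAt_iff_hasDerivWithinAt, hasDerivWithinAt_univ]
  fin_cases i
  · simpa [sph] using hf.sin.fun_mul hg.cos
  · simpa [sph] using hf.sin.fun_mul hg.sin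
  · simpa [sph] using hf.cos

theorem contDiff_sph {f g : ℝ → ℝ} (hf : ContDiff ℝ ∞ f) (hg : ContDiff ℝ ∞ g) :
    ContDiff ℝ ∞ (fun t => sph (f t) (g t)) := by
  rw [contDiff_euclidean]
  intro i
  fin_cases i
  · simpa [sph] using hf.sin.mul hg.cos
  · simpa [sph] using hf.sin.mul hg.sin
  · simpa [sph] using hf.cos

theorem derivWithin_windingArc {t : ℝ} (ht : t ∈ I01) :
    derivWithin windingArc I01 t =
      (!₂[Real.cos (Real.pi * ((1 + t) / 3)) * (Real.pi / 3) * Real.cos (2 * Real.pi * t)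
          + Real.sin (Real.pi * ((1 + t) / 3)) * (-Real.sin (2 * Real.pi * t) * (2 * Real.pi)),
        Real.cos (Real.pi * ((1 + t) / 3)) * (Real.pi / 3) * Real.sin (2 * Real.pi * t)
          + Real.sin (Real.pi * ((1 + t) / 3)) * (Real.cos (2 * Real.pi * t) * (2 * Real.pi)),
        -Real.sin (Real.pi * ((1 + t) / 3)) * (Real.pi / 3)] : E3) := by
  have hf : HasDerivAt (fun t : ℝ => Real.pi * ((1 + t) / 3)) (Real.pi / 3) t := by
    have := (((hasDerivAt_id t).const_add 1).div_const 3).const_mul Real.pi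
    simpa [div_eq_mul_inv] using this
  have hg : HasDerivAt (fun t : ℝ => 2 * Real.pi * t) (2 * Real.pi) t := by
    simpa using (hasDerivAt_id t).const_mul (2 * Real.pi)
  exact (hasDerivAt_sph hf hg).hasDerivWithinAt.derivWithin
    (uniqueDiffOn_Icc zero_lt_one t ht)

theorem deriv_interval (x : ℝ) :
    deriv interval x =
      (!₂[Real.cos (Real.pi * x) * Real.pi, 0, -Real.sin (Real.pi * x) * Real.pi] : E3) := by
  have hf : HasDerivAt (fun t : ℝ => Real.pi * t) Real.pi x := by
    simpa using (hasDerivAt_id x).const_mul Real.pi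
  have := (hasDerivAt_sph hf (hasDerivAt_const x (0 : ℝ))).deriv
  change deriv (fun t => sph (Real.pi * t) 0) x = _
  simpa using this

theorem windingArc_isImmersedArc : IsImmersedArc windingArc where
  smooth := by
    refine (contDiff_sph ?_ ?_).contDiffOn <;> fun_prop
  mem_sphere := by
    intro t _
    rw [mem_sphere_zero_iff_norm, EuclideanSpace.norm_eq, Real.sqrt_eq_one]
    simp only [windingArc, sph, Fin.sum_univ_three, Real.norm_eq_abs, sq_abs]
    simp
    nlinarith [Real.sin_sq_add_cos_sq (2 * Real.pi * t),
      Real.sin_sq_add_cos_sq (Real.pi * ((1 + t) / 3))]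
  ne_leg := by
    intro t ht h
    have h2 : Real.cos (Real.pi * ((1 + t) / 3)) = 1 := by
      have := congrArg (fun v : E3 => v 2) h
      simpa [windingArc, sph, leg, interval] using this
    have := sin_polar_pos ht
    nlinarith [Real.sin_sq_add_cos_sq (Real.pi * ((1 + t) / 3))]
  ne_head := by
    intro t ht h
    have h2 : Real.cos (Real.pi * ((1 + t) / 3)) = -1 := by
      have := congrArg (fun v : E3 => v 2) h
      simpa [windingArc, sph, head, interval] using this
    have := sin_polar_pos ht
    nlinarith [Real.sin_sq_add_cos_sq (Real.pi * ((1 + t) / 3))]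
  immersed := by
    intro t ht h
    rw [derivWithin_windingArc ht] at h
    have h2 := congrArg (fun v : E3 => v 2) h
    have := sin_polar_pos ht
    have hpi := Real.pi_pos
    simp [hpi.ne', this.ne'] at h2

theorem windingArc_isGeneric : IsGeneric windingArc where
  self_transverse := fun _ ht _ hu hne h => absurd (windingArc_injOn ht hu h) hne
  no_triple := fun _ ht _ hu _ _ h _ => Or.inl (windingArc_injOn ht hu h)
  double_off_interval := fun _ ht _ hu hne h => absurd (windingArc_injOn ht hu h) hne
  interval_transverse := by
    intro t ht x _ h
    have hpi := Real.pi_pos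
    have hs := sin_polar_pos ht
    have hsin : Real.sin (2 * Real.pi * t) = 0 := by
      have := congrArg (fun v : E3 => v 1) h
      simp [windingArc, sph, interval] at this
      rcases this with h1 | h1
      · linarith
      · exact h1
    have hcos : Real.cos (2 * Real.pi * t) ≠ 0 := by
      intro h0
      have := Real.sin_sq_add_cos_sq (2 * Real.pi * t)
      rw [hsin, h0] at this
      norm_num at this
    rw [derivWithin_windingArc ht, deriv_interval, LinearIndependent.pair_iff]
    intro a b hab
    have h0 := congrArg (fun v : E3 => v 0) hab
    have h1 := congrArg (fun v : E3 => v 1) hab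
    have h2 := congrArg (fun v : E3 => v 2) hab
    have ha : a = 0 := by
      simp [hsin, hcos, hs.ne', hpi.ne'] at h1
      exact h1
    subst ha
    simp [hpi.ne'] at h0 h2
    refine ⟨rfl, ?_⟩
    by_contra hb
    have e0 := h0.resolve_left hb
    have e2 := h2.resolve_left hb
    have := Real.sin_sq_add_cos_sq (Real.pi * x)
    rw [e0, e2] at this
    norm_num at this

/-- The linear chord diagram whose chord goes exactly once counterclockwise around the leg. -/
def windingDiagram : LinearChordDiagram where
  start := 1 / 3
  dest := 2 / 3
  start_pos := by norm_num
  start_lt_dest := by norm_num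
  dest_lt_one := by norm_num
  chord := windingArc
  isImmersedArc := windingArc_isImmersedArc
  isGeneric := windingArc_isGeneric
  chord_zero := by simp [windingArc, interval]
  chord_one := by
    simp only [windingArc, interval, sph, mul_one, Real.cos_two_pi, Real.sin_two_pi,
      Real.cos_zero, Real.sin_zero]
    norm_num

/-- The element `a` of `A₁ˡ`: the chord winding once, counterclockwise, around the leg. -/
def a : A1l := windingDiagram.toA1l

end

end Knotoid

/-! The sphere without the poles is a cylinder, and `merc` is its universal covering by the plane:
the real part is the Mercator height, the imaginary part the longitude. The open interval is covered
by the lines on which the longitude lies in 2πℤ. A chord therefore lifts to an immersed planar arc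
that starts at longitude 0 and ends at longitude 2πw; this w is its winding number around the leg.

The winding number is invariant under flat isotopy: the total change of longitude is the imaginary
part of the integral of a logarithmic derivative, depends continuously on the isotopy parameter, and
takes values in 2πℤ (`FlatIsotopic.hasWinding`).

It is also a complete invariant. The tangent directions at the ends are free to vary, so no rotation
number obstructs a regular homotopy. The start of a chord lies on the interval and double points do
not, so the lift K never returns to its start. Hence the initial pieces of K on [0,σ], normalized by
similarities to run from 0 to 1, form a regular homotopy from K to a straight segment as σ decreases
to 0 (`zoom`). Two lifts are joined through this segment (`blend`), while affine maps of the plane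
keep the ends above the moving marked points (`flatIsotopic_of_diffeo`). Some diffeomorphism of the
interval always matches the marked points (`exists_diffeo`).

Winding numbers add under concatenation, because the connecting arc lies in a hemisphere carrying a
branch of the longitude that vanishes on the interval (`IsConcatenation.hasWinding`). Explicit
chords, graphs of longitude over height, realize every pair of winding numbers by a concatenation
(`exists_isConcatenation`). So `winding` is a bijection onto ℤ that turns concatenation into
addition and sends `a` to 1, and the group structure is transported from ℤ. -/

namespace Knotoid

noncomputable section

/-! ### The Mercator covering of the sphere without the poles -/

/-- The polar angle at height `x` on the Mercator chart. -/
def polar (x : ℝ) : ℝ := 2 * Real.arctan (Real.exp x)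

/-- The height on the Mercator chart of the points of polar angle `θ`; it is the inverse
of `polar`. -/
def height (θ : ℝ) : ℝ := Real.log (Real.tan (θ / 2))

theorem polar_pos (x : ℝ) : 0 < polar x := by
  have := Real.arctan_pos.2 (Real.exp_pos x)
  unfold polar; linarith

theorem polar_lt_pi (x : ℝ) : polar x < Real.pi := by
  have := Real.arctan_lt_pi_div_two (Real.exp x)
  unfold polar; linarith

theorem sin_polar (x : ℝ) : 0 < Real.sin (polar x) :=
  Real.sin_pos_of_pos_of_lt_pi (polar_pos x) (polar_lt_pi x)

theorem polar_strictMono : StrictMono polar := fun x y h => by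
  have := Real.arctan_strictMono (Real.exp_strictMono h)
  unfold polar; linarith

theorem contDiff_polar : ContDiff ℝ ∞ polar :=
  contDiff_const.mul (Real.contDiff_arctan.comp Real.contDiff_exp)

theorem hasDerivAt_polar (x : ℝ) :
    HasDerivAt polar (2 * (1 / (1 + Real.exp x ^ 2) * Real.exp x)) x :=
  (Real.hasDerivAt_exp x).arctan.const_mul 2

theorem polar_height {θ : ℝ} (h0 : 0 < θ) (h1 : θ < Real.pi) : polar (height θ) = θ := by
  have ht : 0 < Real.tan (θ / 2) := Real.tan_pos_of_pos_of_lt_pi_div_two (by linarith) (by linarith)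
  rw [polar, height, Real.exp_log ht, Real.arctan_tan (by linarith) (by linarith)]
  ring

theorem height_polar (x : ℝ) : height (polar x) = x :=
  polar_strictMono.injective (polar_height (polar_pos x) (polar_lt_pi x))

theorem contDiffAt_height {θ : ℝ} (h0 : 0 < θ) (h1 : θ < Real.pi) :
    ContDiffAt ℝ ∞ height θ := by
  have ht : 0 < Real.tan (θ / 2) := Real.tan_pos_of_pos_of_lt_pi_div_two (by linarith) (by linarith)
  have hc : 0 < Real.cos (θ / 2) := Real.cos_pos_of_mem_Ioo ⟨by linarith, by linarith⟩
  have : ContDiffAt ℝ ∞ (fun θ : ℝ => Real.tan (θ / 2)) θ :=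
    (Real.contDiffAt_tan.2 hc.ne').comp (f := fun θ : ℝ => θ / 2) θ
      (contDiffAt_id.div_const (2 : ℝ))
  exact this.log ht.ne'

theorem height_lt_height {θ θ' : ℝ} (h0 : 0 < θ) (h : θ < θ') (h1 : θ' < Real.pi) :
    height θ < height θ' := by
  rw [← polar_strictMono.lt_iff_lt, polar_height h0 (h.trans h1), polar_height (h0.trans h) h1]
  exact h

/-- The Mercator parametrization of the sphere without the poles. -/
def merc (z : ℂ) : E3 := sph (polar z.re) z.im

theorem sph_apply_zero (θ ψ : ℝ) : sph θ ψ 0 = Real.sin θ * Real.cos ψ := rfl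
theorem sph_apply_one (θ ψ : ℝ) : sph θ ψ 1 = Real.sin θ * Real.sin ψ := rfl
theorem sph_apply_two (θ ψ : ℝ) : sph θ ψ 2 = Real.cos θ := rfl

theorem contDiff_merc : ContDiff ℝ ∞ merc := by
  have hr : ContDiff ℝ ∞ (fun z : ℂ => polar z.re) :=
    contDiff_polar.comp Complex.reCLM.contDiff
  have hi : ContDiff ℝ ∞ (fun z : ℂ => z.im) := Complex.imCLM.contDiff
  rw [contDiff_euclidean]
  intro i
  fin_cases i
  · exact hr.sin.mul hi.cos
  · exact hr.sin.mul hi.sin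
  · exact hr.cos

/-- This lets planar immersions descend to immersions in the sphere. In the derivative along the
line z + tv, the third coordinate forces v.re = 0; the other two then force v.im = 0, since sine and
cosine have no common zero. -/
theorem fderiv_merc_injective (z : ℂ) : Function.Injective (fderiv ℝ merc z) := by
  rw [injective_iff_map_eq_zero]
  intro v hv
  have hf : HasDerivAt (fun t : ℝ => polar (z.re + t * v.re))
      (2 * (1 / (1 + Real.exp z.re ^ 2) * Real.exp z.re) * v.re) 0 := by
    have h1 : HasDerivAt (fun t : ℝ => z.re + t * v.re) v.re 0 := by
      simpa using ((hasDerivAt_id (0 : ℝ)).mul_const v.re).const_add z.re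
    have h2 : HasDerivAt polar (2 * (1 / (1 + Real.exp z.re ^ 2) * Real.exp z.re))
        (z.re + 0 * v.re) := by simpa using hasDerivAt_polar z.re
    exact HasDerivAt.comp (h₂ := polar) (0 : ℝ) h2 h1
  have hg : HasDerivAt (fun t : ℝ => z.im + t * v.im) v.im 0 := by
    simpa using ((hasDerivAt_id (0 : ℝ)).mul_const v.im).const_add z.im
  have hE := hasDerivAt_sph hf hg
  have hl : HasDerivAt (fun t : ℝ => z + t * v) v 0 := by
    simpa using ((Complex.ofRealCLM.hasDerivAt (x := (0 : ℝ))).mul_const v).const_add z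
  have hm : HasFDerivAt merc (fderiv ℝ merc z) (z + (0 : ℝ) * v) := by
    simpa using (contDiff_merc.differentiable (by simp) z).hasFDerivAt
  have hE' := hm.comp_hasDerivAt (0 : ℝ) hl
  have heq : (merc ∘ fun t : ℝ => z + t * v) =
      fun t : ℝ => sph (polar (z.re + t * v.re)) (z.im + t * v.im) := by
    funext t; simp [merc]
  rw [heq, hv] at hE'
  have h := hE.unique hE'
  have hs := sin_polar z.re
  have he := Real.exp_pos z.re
  have hd : 0 < 1 + Real.exp z.re ^ 2 := by positivity
  have h0 := congrArg (fun v : E3 => v 0) h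
  have h1 := congrArg (fun v : E3 => v 1) h
  have h2 := congrArg (fun v : E3 => v 2) h
  simp [hs.ne', hd.ne'] at h0 h1 h2
  simp [h2] at h0 h1
  apply Complex.ext
  · exact h2
  · by_contra hne
    have e0 := (h0.resolve_left hs.ne').resolve_right hne
    have e1 := (h1.resolve_left hs.ne').resolve_right hne
    have := Real.sin_sq_add_cos_sq z.im
    rw [e0, e1] at this
    norm_num at this

theorem merc_mem_sphere (z : ℂ) : merc z ∈ Metric.sphere (0 : E3) 1 := by
  rw [mem_sphere_zero_iff_norm, EuclideanSpace.norm_eq, Real.sqrt_eq_one]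
  simp only [merc, Fin.sum_univ_three, Real.norm_eq_abs, sq_abs, sph_apply_zero, sph_apply_one,
    sph_apply_two]
  nlinarith [Real.sin_sq_add_cos_sq z.im, Real.sin_sq_add_cos_sq (polar z.re)]

theorem merc_ne_leg (z : ℂ) : merc z ≠ leg := by
  intro h
  have h2 := congrArg (fun v : E3 => v 2) h
  simp [merc, leg, interval, sph_apply_two] at h2
  nlinarith [Real.sin_sq_add_cos_sq (polar z.re), sin_polar z.re]

theorem merc_ne_head (z : ℂ) : merc z ≠ head := by
  intro h
  have h2 := congrArg (fun v : E3 => v 2) h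
  simp [merc, head, interval, sph_apply_two] at h2
  nlinarith [Real.sin_sq_add_cos_sq (polar z.re), sin_polar z.re]

theorem interval_eq_merc {x : ℝ} (h0 : 0 < x) (h1 : x < 1) (w : ℤ) :
    interval x = merc ⟨height (Real.pi * x), 2 * Real.pi * w⟩ := by
  have hpi := Real.pi_pos
  have h := polar_height (θ := Real.pi * x) (by positivity) (by nlinarith)
  have hc : Real.cos (2 * Real.pi * w) = 1 := by
    rw [mul_comm]; exact Real.cos_int_mul_two_pi w
  have hs : Real.sin (2 * Real.pi * w) = 0 := by
    rw [Real.sin_eq_zero_iff]; exact ⟨2 * w, by push_cast; ring⟩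
  simp only [merc, interval, h]
  simp [sph, hc, hs]

theorem merc_re_eq {z z' : ℂ} (h : merc z = merc z') : z.re = z'.re := by
  have h2 := congrArg (fun v : E3 => v 2) h
  exact polar_strictMono.injective (Real.injOn_cos ⟨(polar_pos _).le, (polar_lt_pi _).le⟩
    ⟨(polar_pos _).le, (polar_lt_pi _).le⟩ h2)

theorem derivWithin_merc_comp {K : ℝ → ℂ} {t : ℝ} (ht : t ∈ I01)
    (hK : DifferentiableWithinAt ℝ K I01 t) :
    derivWithin (fun t => merc (K t)) I01 t = fderiv ℝ merc (K t) (derivWithin K I01 t) :=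
  ((contDiff_merc.differentiable (by simp) _).hasFDerivAt.comp_hasDerivWithinAt t
    hK.hasDerivWithinAt).derivWithin (uniqueDiffOn_Icc zero_lt_one t ht)

theorem isImmersedArc_merc {K : ℝ → ℂ} (hK : ContDiffOn ℝ ∞ K I01)
    (hK' : ∀ t ∈ I01, derivWithin K I01 t ≠ 0) : IsImmersedArc (fun t => merc (K t)) where
  smooth := contDiff_merc.comp_contDiffOn hK
  mem_sphere _ _ := merc_mem_sphere _
  ne_leg _ _ := merc_ne_leg _
  ne_head _ _ := merc_ne_head _
  immersed t ht := by
    rw [derivWithin_merc_comp ht (hK.differentiableOn (by simp) t ht)]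
    intro h
    exact hK' t ht (fderiv_merc_injective _ (h.trans (map_zero _).symm))

/-! ### Continuous longitudes and their total change -/

/-- The nearest point projection of the line onto `[0,1]`. -/
def clamp (t : ℝ) : ℝ := max 0 (min t 1)

theorem clamp_mem (t : ℝ) : clamp t ∈ I01 :=
  ⟨le_max_left _ _, max_le zero_le_one (min_le_right _ _)⟩

theorem clamp_of_mem {t : ℝ} (ht : t ∈ I01) : clamp t = t := by
  rw [clamp, min_eq_left ht.2, max_eq_right ht.1]

theorem continuous_clamp : Continuous clamp := by unfold clamp; fun_prop

/-- A continuous map from a connected set to the discrete space ℤ is constant. -/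
theorem eq_of_continuousOn_of_int_mul {f : ℝ → ℝ} (hf : ContinuousOn f I01)
    (h : ∀ t ∈ I01, ∃ n : ℤ, f t = 2 * Real.pi * n) : f 0 = f 1 := by
  choose! n hn using h
  have hpi : (2 * Real.pi) ≠ 0 := by positivity
  have hc : ContinuousOn n I01 := by
    rw [Int.isClosedEmbedding_coe_real.isInducing.continuousOn_iff]
    refine (hf.div_const (2 * Real.pi)).congr fun t ht => ?_
    simp [hn t ht, hpi]
  have h0 : (0 : ℝ) ∈ I01 := by simp
  have h1 : (1 : ℝ) ∈ I01 := by simp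
  rw [hn 0 h0, hn 1 h1, isPreconnected_Icc.constant hc h0 h1]

/-- `θ` is a continuous choice of longitude along the curve `c`. -/
def IsAngle (c : ℝ → E3) (θ : ℝ → ℝ) : Prop :=
  ContinuousOn θ I01 ∧
    ∀ t ∈ I01, ∃ r > 0, c t 0 = r * Real.cos (θ t) ∧ c t 1 = r * Real.sin (θ t)

theorem eq_add_int_of_polar {r r' x y : ℝ} (hr : 0 < r) (hr' : 0 < r')
    (hc : r * Real.cos x = r' * Real.cos y) (hs : r * Real.sin x = r' * Real.sin y) :
    ∃ n : ℤ, x - y = 2 * Real.pi * n := by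
  have hsq : r ^ 2 = r' ^ 2 := by
    linear_combination r' ^ 2 * Real.sin_sq_add_cos_sq y - r ^ 2 * Real.sin_sq_add_cos_sq x
      + (r * Real.cos x + r' * Real.cos y) * hc + (r * Real.sin x + r' * Real.sin y) * hs
  have : r = r' := by nlinarith
  subst this
  have hc' := mul_left_cancel₀ hr.ne' hc
  have hs' := mul_left_cancel₀ hr.ne' hs
  have h1 : Real.cos (x - y) = 1 := by
    rw [Real.cos_sub, hc', hs']; nlinarith [Real.sin_sq_add_cos_sq y]
  obtain ⟨n, hn⟩ := (Real.cos_eq_one_iff _).1 h1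
  exact ⟨n, by linarith⟩

/-- Two continuous longitudes along one curve differ by a continuous function with values in 2πℤ,
hence by a constant. -/
theorem IsAngle.sub_eq {c : ℝ → E3} {θ θ' : ℝ → ℝ} (h : IsAngle c θ) (h' : IsAngle c θ') :
    θ 1 - θ 0 = θ' 1 - θ' 0 := by
  have := eq_of_continuousOn_of_int_mul (h.1.sub h'.1) fun t ht => by
    obtain ⟨r, hr, e0, e1⟩ := h.2 t ht
    obtain ⟨r', hr', e0', e1'⟩ := h'.2 t ht
    exact eq_add_int_of_polar hr hr' (e0.symm.trans e0') (e1.symm.trans e1')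
  simp only [Pi.sub_apply] at this
  linarith

theorem isAngle_of_merc {c : ℝ → E3} {K : ℝ → ℂ} (hK : ContinuousOn K I01)
    (h : ∀ t ∈ I01, c t = merc (K t)) : IsAngle c (fun t => (K t).im) :=
  ⟨Complex.continuous_im.comp_continuousOn hK, fun t ht =>
    ⟨_, sin_polar (K t).re, by rw [h t ht]; rfl, by rw [h t ht]; rfl⟩⟩

theorem eq_of_merc_eq_interval {z : ℂ} {x : ℝ} (h0 : 0 < x) (h1 : x < 1)
    (h : merc z = interval x) : ∃ n : ℤ, z = ⟨height (Real.pi * x), 2 * Real.pi * n⟩ := by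
  rw [interval_eq_merc h0 h1 0] at h
  have hr := merc_re_eq h
  have e0 := congrArg (fun v : E3 => v 0) h
  have e1 := congrArg (fun v : E3 => v 1) h
  obtain ⟨n, hn⟩ := eq_add_int_of_polar (sin_polar _) (sin_polar _) e0 e1
  exact ⟨n, Complex.ext hr (by simpa using hn)⟩

/-! ### Lifting arcs by integrating the logarithmic derivative -/

/-- The projection of space to the equatorial plane. -/
def planar : E3 →L[ℝ] ℂ :=
  (EuclideanSpace.proj (𝕜 := ℝ) (0 : Fin 3)).smulRight (1 : ℂ) +
    (EuclideanSpace.proj (𝕜 := ℝ) (1 : Fin 3)).smulRight Complex.I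

theorem planar_re (v : E3) : (planar v).re = v 0 := by simp [planar]
theorem planar_im (v : E3) : (planar v).im = v 1 := by simp [planar]

theorem sq_add_sq_add_sq {v : E3} (hv : v ∈ Metric.sphere (0 : E3) 1) :
    v 0 ^ 2 + v 1 ^ 2 + v 2 ^ 2 = 1 := by
  rw [mem_sphere_zero_iff_norm, EuclideanSpace.norm_eq, Real.sqrt_eq_one] at hv
  simpa [Fin.sum_univ_three] using hv

theorem planar_ne_zero {v : E3} (hv : v ∈ Metric.sphere (0 : E3) 1) (hl : v ≠ leg)
    (hh : v ≠ head) : planar v ≠ 0 := by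
  intro h
  have h0 : v 0 = 0 := by rw [← planar_re, h]; rfl
  have h1 : v 1 = 0 := by rw [← planar_im, h]; rfl
  have h2 := sq_add_sq_add_sq hv
  have h3 : (v 2 - 1) * (v 2 + 1) = 0 := by rw [h0, h1] at h2; linarith
  rcases mul_eq_zero.1 h3 with h3 | h3
  · apply hl
    ext i; fin_cases i
    · simp [leg, interval, sph, h0]
    · simp [leg, interval, sph, h1]
    · simp [leg, interval, sph]; linarith
  · apply hh
    ext i; fin_cases i
    · simp [head, interval, sph, h0]
    · simp [head, interval, sph, h1]
    · simp [head, interval, sph]; linarith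

/-- The logarithmic derivative of the projection of a curve to the equatorial plane. -/
def logDer (c : ℝ → E3) (t : ℝ) : ℂ := planar (derivWithin c I01 t) / planar (c t)

theorem IsImmersedArc.planar_ne_zero {c : ℝ → E3} (hc : IsImmersedArc c) {t : ℝ} (ht : t ∈ I01) :
    planar (c t) ≠ 0 :=
  Knotoid.planar_ne_zero (hc.mem_sphere t ht) (hc.ne_leg t ht) (hc.ne_head t ht)

theorem IsImmersedArc.contDiffOn_logDer {c : ℝ → E3} (hc : IsImmersedArc c) :
    ContDiffOn ℝ ∞ (logDer c) I01 := by
  have h1 : ContDiffOn ℝ ∞ (fun t => planar (derivWithin c I01 t)) I01 :=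
    planar.contDiff.comp_contDiffOn
      (hc.smooth.derivWithin (uniqueDiffOn_Icc zero_lt_one) (by simp))
  have h2 : ContDiffOn ℝ ∞ (fun t => planar (c t)) I01 :=
    planar.contDiff.comp_contDiffOn hc.smooth
  have h3 := h1.mul (h2.inv fun t ht => hc.planar_ne_zero ht)
  exact h3.congr fun t _ => div_eq_mul_inv _ _

/-- The primitive of the logarithmic derivative. -/
def logInt (c : ℝ → E3) (t : ℝ) : ℂ := ∫ u in (0 : ℝ)..t, logDer c (clamp u)

theorem IsImmersedArc.hasDerivAt_logInt {c : ℝ → E3} (hc : IsImmersedArc c) (t : ℝ) :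
    HasDerivAt (logInt c) (logDer c (clamp t)) t := by
  have h : Continuous fun u => logDer c (clamp u) :=
    hc.contDiffOn_logDer.continuousOn.comp_continuous continuous_clamp clamp_mem
  exact intervalIntegral.integral_hasDerivAt_right (h.intervalIntegrable _ _)
    h.stronglyMeasurable.stronglyMeasurableAtFilter h.continuousAt

theorem IsImmersedArc.contDiffOn_logInt {c : ℝ → E3} (hc : IsImmersedArc c) :
    ContDiffOn ℝ ∞ (logInt c) I01 := by
  have hu : UniqueDiffOn ℝ I01 := uniqueDiffOn_Icc zero_lt_one
  rw [contDiffOn_infty_iff_derivWithin hu]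
  refine ⟨fun t _ => (hc.hasDerivAt_logInt t).differentiableAt.differentiableWithinAt, ?_⟩
  refine hc.contDiffOn_logDer.congr fun t ht => ?_
  rw [(hc.hasDerivAt_logInt t).hasDerivWithinAt.derivWithin (hu t ht), clamp_of_mem ht]

/-- The product of the projected curve with exp(-`logInt`) has derivative zero. -/
theorem IsImmersedArc.planar_eq {c : ℝ → E3} (hc : IsImmersedArc c) {t : ℝ} (ht : t ∈ I01) :
    planar (c t) = planar (c 0) * Complex.exp (logInt c t) := by
  have hd : ∀ u ∈ I01, HasDerivWithinAt
      (fun u => planar (c u) * Complex.exp (-logInt c u)) 0 I01 u := by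
    intro u hu
    have h1 : HasDerivWithinAt (fun u => planar (c u)) (planar (derivWithin c I01 u)) I01 u :=
      planar.hasFDerivAt.comp_hasDerivWithinAt u
        (hc.smooth.differentiableOn (by simp) u hu).hasDerivWithinAt
    have h2 := (hc.hasDerivAt_logInt u).hasDerivWithinAt (s := I01)
    rw [clamp_of_mem hu] at h2
    have := hc.planar_ne_zero hu
    refine (h1.fun_mul h2.fun_neg.cexp).congr_deriv ?_
    simp only [logDer]
    field_simp
    ring
  have h := constant_of_derivWithin_zero (fun u hu => (hd u hu).differentiableWithinAt)
    (fun u hu => (hd u (Set.Ico_subset_Icc_self hu)).derivWithin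
      (uniqueDiffOn_Icc zero_lt_one u (Set.Ico_subset_Icc_self hu))) t ht
  simp only [logInt, intervalIntegral.integral_same, neg_zero, Complex.exp_zero, mul_one] at h
  rw [← h, mul_assoc, ← Complex.exp_add]
  simp [logInt]

/-- The longitude of the lift is the imaginary part of `logInt`, and its height comes from the third
coordinate. Naming the longitude at time 1 explicitly makes its dependence on the arc accessible to
continuity arguments. -/
theorem IsImmersedArc.exists_lift {c : ℝ → E3} (hc : IsImmersedArc c) {p : ℝ} (hp : 0 < p)
    (hp1 : p < 1) (h0 : c 0 = interval p) :
    ∃ K : ℝ → ℂ, ContDiffOn ℝ ∞ K I01 ∧ (∀ t ∈ I01, c t = merc (K t)) ∧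
      K 0 = ⟨height (Real.pi * p), 0⟩ ∧ (K 1).im = (logInt c 1).im := by
  have hpi := Real.pi_pos
  have hsp : 0 < Real.sin (Real.pi * p) :=
    Real.sin_pos_of_pos_of_lt_pi (by positivity) (by nlinarith)
  have hlt : ∀ t ∈ I01, -1 < c t 2 ∧ c t 2 < 1 := by
    intro t ht
    have h := sq_add_sq_add_sq (hc.mem_sphere t ht)
    have hne : 0 < c t 0 ^ 2 + c t 1 ^ 2 := by
      by_contra hcon
      have e0 : c t 0 = 0 := by nlinarith [sq_nonneg (c t 0), sq_nonneg (c t 1)]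
      have e1 : c t 1 = 0 := by nlinarith [sq_nonneg (c t 0), sq_nonneg (c t 1)]
      exact hc.planar_ne_zero ht (Complex.ext (by simp [planar_re, e0]) (by simp [planar_im, e1]))
    constructor <;> nlinarith
  have hθ : ∀ t ∈ I01, 0 < Real.arccos (c t 2) ∧ Real.arccos (c t 2) < Real.pi := by
    intro t ht
    refine ⟨Real.arccos_pos.2 (hlt t ht).2, lt_of_le_of_ne (Real.arccos_le_pi _) fun h => ?_⟩
    rw [Real.arccos_eq_pi] at h
    linarith [(hlt t ht).1]
  refine ⟨fun t => (height (Real.arccos (c t 2)) : ℂ) + (logInt c t).im * Complex.I,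
    ?_, ?_, ?_, ?_⟩
  · have h1 : ContDiffOn ℝ ∞ (fun t => height (Real.arccos (c t 2))) I01 := by
      intro t ht
      have hz : ContDiffWithinAt ℝ ∞ (fun t => c t 2) I01 t :=
        (contDiffWithinAt_euclidean.1 (hc.smooth t ht)) 2
      have ha : ContDiffAt ℝ ∞ Real.arccos (c t 2) :=
        Real.contDiffAt_arccos (hlt t ht).1.ne' (hlt t ht).2.ne
      exact ContDiffAt.comp_contDiffWithinAt (g := height) (f := fun t => Real.arccos (c t 2)) t
        (contDiffAt_height (hθ t ht).1 (hθ t ht).2)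
        (ContDiffAt.comp_contDiffWithinAt (g := Real.arccos) (f := fun t => c t 2) t ha hz)
    have h2 : ContDiffOn ℝ ∞ (fun t => (logInt c t).im) I01 :=
      Complex.imCLM.contDiff.comp_contDiffOn hc.contDiffOn_logInt
    exact (Complex.ofRealCLM.contDiff.comp_contDiffOn h1).add
      ((Complex.ofRealCLM.contDiff.comp_contDiffOn h2).mul contDiffOn_const)
  · intro t ht
    have hz := hc.planar_eq ht
    have hz0 : planar (c 0) = (Real.sin (Real.pi * p) : ℝ) :=
      Complex.ext (by simp only [planar_re, h0, Complex.ofReal_re]; simp [interval, sph])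
        (by simp only [planar_im, h0, Complex.ofReal_im]; simp [interval, sph])
    rw [hz0] at hz
    set r := Real.sin (Real.pi * p) * Real.exp (logInt c t).re
    have hr : 0 < r := by positivity
    have e0 : c t 0 = r * Real.cos (logInt c t).im := by
      rw [← planar_re, hz, Complex.re_ofReal_mul, Complex.exp_re]; ring
    have e1 : c t 1 = r * Real.sin (logInt c t).im := by
      rw [← planar_im, hz, Complex.im_ofReal_mul, Complex.exp_im]; ring
    -- On the unit sphere, both sides are the nonnegative square root of 1 - z², with z the third
    -- coordinate.
    have hs : Real.sin (Real.arccos (c t 2)) = r := by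
      rw [Real.sin_arccos, show 1 - c t 2 ^ 2 = r ^ 2 from ?_, Real.sqrt_sq hr.le]
      have h := sq_add_sq_add_sq (hc.mem_sphere t ht)
      rw [e0, e1] at h
      nlinarith [Real.sin_sq_add_cos_sq (logInt c t).im]
    ext i
    fin_cases i
    · simp [merc, sph, polar_height (hθ t ht).1 (hθ t ht).2, hs, e0]
    · simp [merc, sph, polar_height (hθ t ht).1 (hθ t ht).2, hs, e1]
    · simp [merc, sph, polar_height (hθ t ht).1 (hθ t ht).2,
        Real.cos_arccos (hlt t ht).1.le (hlt t ht).2.le]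
  · have : c 0 2 = Real.cos (Real.pi * p) := by simp [h0, interval, sph]
    simp only [this, Real.arccos_cos (show 0 ≤ Real.pi * p by positivity)
      (show Real.pi * p ≤ Real.pi by nlinarith)]
    apply Complex.ext <;> simp [logInt]
  · simp

/-! ### The winding number and its invariance under flat isotopy -/

/-- The chord of `D` winds `w` times around the leg. -/
def HasWinding (D : LinearChordDiagram) (w : ℤ) : Prop :=
  ∃ θ, IsAngle D.chord θ ∧ θ 1 - θ 0 = 2 * Real.pi * w

theorem HasWinding.unique {D : LinearChordDiagram} {w w' : ℤ} (h : HasWinding D w)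
    (h' : HasWinding D w') : w = w' := by
  obtain ⟨θ, hθ, e⟩ := h
  obtain ⟨θ', hθ', e'⟩ := h'
  have := hθ.sub_eq hθ'
  rw [e, e'] at this
  exact_mod_cast mul_left_cancel₀ (by positivity) this

theorem LinearChordDiagram.start_lt_one (D : LinearChordDiagram) : D.start < 1 :=
  D.start_lt_dest.trans D.dest_lt_one

theorem LinearChordDiagram.dest_pos (D : LinearChordDiagram) : 0 < D.dest :=
  D.start_pos.trans D.start_lt_dest

theorem LinearChordDiagram.exists_lift (D : LinearChordDiagram) :
    ∃ (K : ℝ → ℂ) (w : ℤ), ContDiffOn ℝ ∞ K I01 ∧ (∀ t ∈ I01, D.chord t = merc (K t)) ∧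
      K 0 = ⟨height (Real.pi * D.start), 0⟩ ∧
      K 1 = ⟨height (Real.pi * D.dest), 2 * Real.pi * w⟩ ∧ HasWinding D w ∧
      (logInt D.chord 1).im = 2 * Real.pi * w := by
  obtain ⟨K, h1, h2, h3, h4⟩ :=
    D.isImmersedArc.exists_lift D.start_pos D.start_lt_one D.chord_zero
  obtain ⟨w, hw⟩ := eq_of_merc_eq_interval D.dest_pos D.dest_lt_one
    ((h2 1 (by simp)).symm.trans D.chord_one)
  refine ⟨K, w, h1, h2, h3, hw, ⟨_, isAngle_of_merc h1.continuousOn h2, ?_⟩, ?_⟩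
  · simp [h3, hw]
  · rw [← h4, hw]

theorem IsIntervalDiffeo.strictMonoOn {f : ℝ → ℝ} (hf : IsIntervalDiffeo f) :
    StrictMonoOn f I01 := by
  refine strictMonoOn_of_deriv_pos (convex_Icc 0 1) hf.smooth.continuousOn fun x hx => ?_
  have hx' := interior_subset hx
  rw [← derivWithin_of_mem_nhds (mem_interior_iff_mem_nhds.1 hx)]
  exact hf.deriv_pos x hx'

theorem IsIntervalDiffeo.mem_Ioo {f : ℝ → ℝ} (hf : IsIntervalDiffeo f) {x : ℝ} (h0 : 0 < x)
    (h1 : x < 1) : 0 < f x ∧ f x < 1 := by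
  have e0 := hf.strictMonoOn (a := 0) (b := x) (by simp) ⟨h0.le, h1.le⟩ h0
  have e1 := hf.strictMonoOn (a := x) (b := 1) ⟨h0.le, h1.le⟩ (by simp) h1
  rw [hf.map_zero] at e0
  rw [hf.map_one] at e1
  exact ⟨e0, e1⟩

theorem logInt_congr {c c' : ℝ → E3} (h : Set.EqOn c c' I01) : logInt c 1 = logInt c' 1 := by
  unfold logInt
  congr 1
  funext u
  rw [logDer, logDer, h (clamp_mem u), derivWithin_congr h (h (clamp_mem u))]

theorem FlatIsotopic.hasWinding {D D' : LinearChordDiagram} (h : FlatIsotopic D D') {w : ℤ}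
    (hw : HasWinding D w) : HasWinding D' w := by
  obtain ⟨φ, H, -, hφ, -, -, -, hH, hH', him, hends, h0, h1⟩ := h
  obtain ⟨-, w₀, -, -, -, -, hw₀, e₀⟩ := D.exists_lift
  obtain ⟨-, w₁, -, -, -, -, hw₁, e₁⟩ := D'.exists_lift
  -- Here the joint continuity of the velocities is essential: it makes the integrand continuous in
  -- both variables.
  have hcont : Continuous fun s => logInt (H (clamp s)) 1 := by
    refine intervalIntegral.continuous_parametric_intervalIntegral_of_continuous' ?_ _ _
    have hc : Continuous fun z : ℝ × ℝ => (clamp z.1, clamp z.2) :=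
      (continuous_clamp.comp continuous_fst).prodMk (continuous_clamp.comp continuous_snd)
    have hm : ∀ z : ℝ × ℝ, (clamp z.1, clamp z.2) ∈ I01 ×ˢ I01 :=
      fun z => ⟨clamp_mem _, clamp_mem _⟩
    exact (planar.continuous.comp (hH'.comp_continuous hc hm)).div
      (planar.continuous.comp (hH.comp_continuous hc hm))
      fun z => (him _ (clamp_mem _)).planar_ne_zero (clamp_mem _)
  -- At every stage the ends of the arc lie on the open interval, so the total change of longitude
  -- lies in 2πℤ.
  have := eq_of_continuousOn_of_int_mul (Complex.continuous_im.comp hcont).continuousOn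
    fun s hs => by
      obtain ⟨p0, p1⟩ := (hφ s hs).mem_Ioo D.start_pos D.start_lt_one
      obtain ⟨q0, q1⟩ := (hφ s hs).mem_Ioo D.dest_pos D.dest_lt_one
      obtain ⟨K, -, k2, -, k4⟩ := (him s hs).exists_lift p0 p1 (hends s hs).1
      obtain ⟨n, hn⟩ := eq_of_merc_eq_interval q0 q1
        ((k2 1 (by simp)).symm.trans (hends s hs).2)
      refine ⟨n, ?_⟩
      simp only [Function.comp_apply, clamp_of_mem hs, ← k4, hn]
  simp only [Function.comp_apply, clamp_of_mem (show (0 : ℝ) ∈ I01 by simp),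
    clamp_of_mem (show (1 : ℝ) ∈ I01 by simp), logInt_congr h0, logInt_congr h1, e₀, e₁] at this
  have hww : (w₀ : ℝ) = w₁ := mul_left_cancel₀ (by positivity) this
  rw [hw.unique hw₀, show w₀ = w₁ by exact_mod_cast hww]
  exact hw₁

/-! ### Straightening planar arcs by zooming in on the start -/

/-- A smooth immersed planar arc which does not return to its start. -/
structure IsLeavingArc (K : ℝ → ℂ) : Prop where
  smooth : ContDiffOn ℝ ∞ K I01
  immersed : ∀ t ∈ I01, derivWithin K I01 t ≠ 0
  ne_start : ∀ t ∈ I01, t ≠ 0 → K t ≠ K 0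

/-- The slope of the secant of `K` from time zero to time `σ`. -/
def secant (K : ℝ → ℂ) : ℝ → ℂ := Function.update (slope K 0) 0 (derivWithin K I01 0)

theorem secant_zero (K : ℝ → ℂ) : secant K 0 = derivWithin K I01 0 := Function.update_self ..

theorem mul_secant (K : ℝ → ℂ) (σ : ℝ) : (σ : ℂ) * secant K σ = K σ - K 0 := by
  rcases eq_or_ne σ 0 with rfl | h
  · simp
  · have : (σ : ℂ) ≠ 0 := by exact_mod_cast h
    simp [secant, Function.update_of_ne h, slope, this]

/-- At time 0 this is the definition of the derivative, which is why the slope is given that value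
there. -/
theorem IsLeavingArc.continuousOn_secant {K : ℝ → ℂ} (hK : IsLeavingArc K) :
    ContinuousOn (secant K) I01 := by
  intro σ hσ
  rcases eq_or_ne σ 0 with rfl | h
  · refine continuousWithinAt_update_same.2 ?_
    exact hasDerivWithinAt_iff_tendsto_slope.1
      (hK.smooth.differentiableOn (by simp) 0 hσ).hasDerivWithinAt
  · refine (continuousWithinAt_update_of_ne h).2 ?_
    have h1 : ContinuousWithinAt (fun σ : ℝ => (σ - 0)⁻¹) I01 σ :=
      ((continuous_id.sub continuous_const).continuousAt.inv₀ (by simpa using h)).continuousWithinAt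
    exact h1.smul ((hK.smooth.continuousOn σ hσ).sub continuousWithinAt_const)

theorem IsLeavingArc.secant_ne_zero {K : ℝ → ℂ} (hK : IsLeavingArc K) {σ : ℝ} (hσ : σ ∈ I01) :
    secant K σ ≠ 0 := by
  rcases eq_or_ne σ 0 with rfl | h
  · rw [secant_zero]; exact hK.immersed 0 hσ
  · intro h0
    have := mul_secant K σ
    rw [h0, mul_zero] at this
    exact hK.ne_start σ hσ h (sub_eq_zero.1 this.symm)

/-- The initial part of `K` up to time `σ`, moved by a similarity so that it runs from `0` to `1`
(and the straight segment for `σ = 0`). -/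
def zoom (K : ℝ → ℂ) (σ t : ℝ) : ℂ := t * secant K (σ * t) / secant K σ

/-- The velocity of `zoom`. -/
def zoomDer (K : ℝ → ℂ) (σ t : ℝ) : ℂ := derivWithin K I01 (σ * t) / secant K σ

theorem mul_mem_I01 {σ t : ℝ} (hσ : σ ∈ I01) (ht : t ∈ I01) : σ * t ∈ I01 :=
  ⟨mul_nonneg hσ.1 ht.1, mul_le_one₀ hσ.2 ht.1 ht.2⟩

theorem IsLeavingArc.zoom_zero {K : ℝ → ℂ} (hK : IsLeavingArc K) (t : ℝ) : zoom K 0 t = t := by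
  have := hK.secant_ne_zero (σ := 0) (by simp)
  simp [zoom, this]

theorem zoom_of_ne {K : ℝ → ℂ} {σ : ℝ} (hσ : σ ≠ 0) (t : ℝ) :
    zoom K σ t = (K (σ * t) - K 0) / (K σ - K 0) := by
  have : (σ : ℂ) ≠ 0 := by exact_mod_cast hσ
  rw [← mul_secant K σ, ← mul_secant K (σ * t), zoom]
  push_cast
  rw [mul_assoc, mul_div_mul_left _ _ this]

theorem zoom_at_zero (K : ℝ → ℂ) (σ : ℝ) : zoom K σ 0 = 0 := by simp [zoom]

theorem IsLeavingArc.zoom_at_one {K : ℝ → ℂ} (hK : IsLeavingArc K) {σ : ℝ} (hσ : σ ∈ I01) :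
    zoom K σ 1 = 1 := by
  simp [zoom, hK.secant_ne_zero hσ]

theorem IsLeavingArc.hasDerivWithinAt_zoom {K : ℝ → ℂ} (hK : IsLeavingArc K) {σ t : ℝ}
    (hσ : σ ∈ I01) (ht : t ∈ I01) : HasDerivWithinAt (zoom K σ) (zoomDer K σ t) I01 t := by
  rcases eq_or_ne σ 0 with rfl | h
  · have h0 := hK.secant_ne_zero (σ := 0) (by simp)
    have h1 : zoom K 0 = fun t : ℝ => (t : ℂ) := funext hK.zoom_zero
    have h2 : zoomDer K 0 t = 1 := by
      rw [zoomDer, zero_mul, ← secant_zero, div_self h0]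
    rw [h1, h2]
    exact Complex.ofRealCLM.hasDerivAt.hasDerivWithinAt
  · have hm : Set.MapsTo (fun t => σ * t) I01 I01 := fun t ht => mul_mem_I01 hσ ht
    have h1 : HasDerivWithinAt (fun t : ℝ => σ * t) σ I01 t := by
      simpa using ((hasDerivAt_id t).const_mul σ).hasDerivWithinAt (s := I01)
    have h2 := (hK.smooth.differentiableOn (by simp) _ (hm ht)).hasDerivWithinAt.scomp t h1 hm
    have h3 := (h2.sub_const (K 0)).div_const (K σ - K 0)
    refine (h3.congr_of_mem (fun u _ => zoom_of_ne h u) ht).congr_deriv ?_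
    have hσ' : (σ : ℂ) ≠ 0 := by exact_mod_cast h
    rw [← mul_secant K σ, Complex.real_smul, mul_div_mul_left _ _ hσ', zoomDer]

/-- The secant quotient need not be differentiated repeatedly: the velocity of `zoom K σ` is a
rescaled copy of the velocity of K, which is visibly smooth. -/
theorem IsLeavingArc.contDiffOn_zoom {K : ℝ → ℂ} (hK : IsLeavingArc K) {σ : ℝ}
    (hσ : σ ∈ I01) : ContDiffOn ℝ ∞ (zoom K σ) I01 := by
  have hu : UniqueDiffOn ℝ I01 := uniqueDiffOn_Icc zero_lt_one
  rw [contDiffOn_infty_iff_derivWithin hu]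
  refine ⟨fun t ht => (hK.hasDerivWithinAt_zoom hσ ht).differentiableWithinAt, ?_⟩
  have h1 : ContDiffOn ℝ ∞ (fun t => derivWithin K I01 (σ * t)) I01 :=
    (hK.smooth.derivWithin hu (by simp)).comp (contDiff_const.mul contDiff_id).contDiffOn
      fun t ht => mul_mem_I01 hσ ht
  exact (h1.div_const (secant K σ)).congr fun t ht =>
    (hK.hasDerivWithinAt_zoom hσ ht).derivWithin (hu t ht)

theorem IsLeavingArc.continuousOn_zoom {K : ℝ → ℂ} (hK : IsLeavingArc K) :
    ContinuousOn (fun z : ℝ × ℝ => zoom K z.1 z.2) (I01 ×ˢ I01) := by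
  have h1 : ContinuousOn (fun z : ℝ × ℝ => secant K (z.1 * z.2)) (I01 ×ˢ I01) :=
    hK.continuousOn_secant.comp (by fun_prop) fun z hz => mul_mem_I01 hz.1 hz.2
  have h2 : ContinuousOn (fun z : ℝ × ℝ => secant K z.1) (I01 ×ˢ I01) :=
    hK.continuousOn_secant.comp (by fun_prop) fun z hz => hz.1
  have h3 : ContinuousOn (fun z : ℝ × ℝ => (z.2 : ℂ)) (I01 ×ˢ I01) := by fun_prop
  exact (h3.mul h1).div h2 fun z hz => hK.secant_ne_zero hz.1

theorem IsLeavingArc.continuousOn_zoomDer {K : ℝ → ℂ} (hK : IsLeavingArc K) :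
    ContinuousOn (fun z : ℝ × ℝ => zoomDer K z.1 z.2) (I01 ×ˢ I01) := by
  have h1 : ContinuousOn (fun z : ℝ × ℝ => derivWithin K I01 (z.1 * z.2)) (I01 ×ˢ I01) :=
    (hK.smooth.continuousOn_derivWithin (uniqueDiffOn_Icc zero_lt_one) (by simp)).comp
      (by fun_prop) fun z hz => mul_mem_I01 hz.1 hz.2
  have h2 : ContinuousOn (fun z : ℝ × ℝ => secant K z.1) (I01 ×ˢ I01) :=
    hK.continuousOn_secant.comp (by fun_prop) fun z hz => hz.1
  exact h1.div h2 fun z hz => hK.secant_ne_zero hz.1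

theorem IsLeavingArc.zoomDer_ne_zero {K : ℝ → ℂ} (hK : IsLeavingArc K) {σ t : ℝ}
    (hσ : σ ∈ I01) (ht : t ∈ I01) : zoomDer K σ t ≠ 0 :=
  div_ne_zero (hK.immersed _ (mul_mem_I01 hσ ht)) (hK.secant_ne_zero hσ)

theorem IsLeavingArc.zoomDer_zero {K : ℝ → ℂ} (hK : IsLeavingArc K) (t : ℝ) :
    zoomDer K 0 t = 1 := by
  rw [zoomDer, zero_mul, ← secant_zero, div_self (hK.secant_ne_zero (by simp))]

/-- The regular homotopy which straightens `K` while `s` runs through `[0,1/2]` and then passes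
from the straight segment to `K'`, all arcs being normalized to run from `0` to `1`. -/
def blend (K K' : ℝ → ℂ) (s t : ℝ) : ℂ :=
  zoom K (max 0 (1 - 2 * s)) t + zoom K' (max 0 (2 * s - 1)) t - t

/-- The velocity of `blend`. -/
def blendDer (K K' : ℝ → ℂ) (s t : ℝ) : ℂ :=
  zoomDer K (max 0 (1 - 2 * s)) t + zoomDer K' (max 0 (2 * s - 1)) t - 1

theorem max_mem_I01 {s : ℝ} (hs : s ∈ I01) :
    max 0 (1 - 2 * s) ∈ I01 ∧ max 0 (2 * s - 1) ∈ I01 := by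
  obtain ⟨h0, h1⟩ := hs
  refine ⟨⟨le_max_left _ _, max_le zero_le_one (by linarith)⟩,
    ⟨le_max_left _ _, max_le zero_le_one (by linarith)⟩⟩

theorem hasDerivWithinAt_blend {K K' : ℝ → ℂ} (hK : IsLeavingArc K) (hK' : IsLeavingArc K')
    {s t : ℝ} (hs : s ∈ I01) (ht : t ∈ I01) :
    HasDerivWithinAt (blend K K' s) (blendDer K K' s t) I01 t :=
  ((hK.hasDerivWithinAt_zoom (max_mem_I01 hs).1 ht).fun_add
    (hK'.hasDerivWithinAt_zoom (max_mem_I01 hs).2 ht)).fun_sub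
    Complex.ofRealCLM.hasDerivAt.hasDerivWithinAt

theorem contDiffOn_blend {K K' : ℝ → ℂ} (hK : IsLeavingArc K) (hK' : IsLeavingArc K')
    {s : ℝ} (hs : s ∈ I01) :
    ContDiffOn ℝ ∞ (blend K K' s) I01 :=
  ((hK.contDiffOn_zoom (max_mem_I01 hs).1).add (hK'.contDiffOn_zoom (max_mem_I01 hs).2)).sub
    Complex.ofRealCLM.contDiff.contDiffOn

theorem continuousOn_blend {K K' : ℝ → ℂ} (hK : IsLeavingArc K) (hK' : IsLeavingArc K') :
    ContinuousOn (fun z : ℝ × ℝ => blend K K' z.1 z.2) (I01 ×ˢ I01) := by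
  have h1 := hK.continuousOn_zoom.comp
    (f := fun z : ℝ × ℝ => (max 0 (1 - 2 * z.1), z.2)) (s := I01 ×ˢ I01) (by fun_prop)
    fun z hz => ⟨(max_mem_I01 hz.1).1, hz.2⟩
  have h2 := hK'.continuousOn_zoom.comp
    (f := fun z : ℝ × ℝ => (max 0 (2 * z.1 - 1), z.2)) (s := I01 ×ˢ I01) (by fun_prop)
    fun z hz => ⟨(max_mem_I01 hz.1).2, hz.2⟩
  have h3 : ContinuousOn (fun z : ℝ × ℝ => (z.2 : ℂ)) (I01 ×ˢ I01) := by fun_prop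
  exact (h1.add h2).sub h3

theorem continuousOn_blendDer {K K' : ℝ → ℂ} (hK : IsLeavingArc K) (hK' : IsLeavingArc K') :
    ContinuousOn (fun z : ℝ × ℝ => blendDer K K' z.1 z.2) (I01 ×ˢ I01) := by
  have h1 := hK.continuousOn_zoomDer.comp
    (f := fun z : ℝ × ℝ => (max 0 (1 - 2 * z.1), z.2)) (s := I01 ×ˢ I01) (by fun_prop)
    fun z hz => ⟨(max_mem_I01 hz.1).1, hz.2⟩
  have h2 := hK'.continuousOn_zoomDer.comp
    (f := fun z : ℝ × ℝ => (max 0 (2 * z.1 - 1), z.2)) (s := I01 ×ˢ I01) (by fun_prop)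
    fun z hz => ⟨(max_mem_I01 hz.1).2, hz.2⟩
  exact (h1.add h2).sub continuousOn_const

/-- At each s at least one of the two zooms is the straight segment. Its velocity 1 cancels the term
-1 and leaves the velocity of the other zoom. -/
theorem blendDer_ne_zero {K K' : ℝ → ℂ} (hK : IsLeavingArc K) (hK' : IsLeavingArc K')
    {s t : ℝ} (hs : s ∈ I01) (ht : t ∈ I01) : blendDer K K' s t ≠ 0 := by
  rcases le_total (2 * s) 1 with h | h
  · have := hK.zoomDer_ne_zero (max_mem_I01 hs).1 ht
    rw [blendDer, max_eq_left (show 2 * s - 1 ≤ 0 by linarith), hK'.zoomDer_zero]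
    simpa using this
  · have := hK'.zoomDer_ne_zero (max_mem_I01 hs).2 ht
    rw [blendDer, max_eq_left (show 1 - 2 * s ≤ 0 by linarith), hK.zoomDer_zero]
    simpa using this

theorem blend_at_zero (K K' : ℝ → ℂ) (s : ℝ) : blend K K' s 0 = 0 := by
  simp [blend, zoom_at_zero]

theorem blend_at_one {K K' : ℝ → ℂ} (hK : IsLeavingArc K) (hK' : IsLeavingArc K')
    {s : ℝ} (hs : s ∈ I01) :
    blend K K' s 1 = 1 := by
  simp [blend, hK.zoom_at_one (max_mem_I01 hs).1, hK'.zoom_at_one (max_mem_I01 hs).2]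

theorem blend_zero {K K' : ℝ → ℂ} (hK' : IsLeavingArc K') (t : ℝ) :
    blend K K' 0 t = (K t - K 0) / (K 1 - K 0) := by
  have : blend K K' 0 t = zoom K 1 t + zoom K' 0 t - t := by norm_num [blend]
  rw [this, hK'.zoom_zero, zoom_of_ne one_ne_zero, one_mul]
  ring

theorem blend_one {K K' : ℝ → ℂ} (hK : IsLeavingArc K) (t : ℝ) :
    blend K K' 1 t = (K' t - K' 0) / (K' 1 - K' 0) := by
  have : blend K K' 1 t = zoom K 0 t + zoom K' 1 t - t := by norm_num [blend]
  rw [this, hK.zoom_zero, zoom_of_ne one_ne_zero, one_mul]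
  ring

/-! ### Equal winding numbers give flat isotopic diagrams -/

theorem LinearChordDiagram.isLeavingArc (D : LinearChordDiagram) {K : ℝ → ℂ}
    (hK : ContDiffOn ℝ ∞ K I01) (h : ∀ t ∈ I01, D.chord t = merc (K t)) : IsLeavingArc K where
  smooth := hK
  immersed t ht h0 := by
    refine D.isImmersedArc.immersed t ht ?_
    rw [derivWithin_congr h (h t ht),
      derivWithin_merc_comp ht (hK.differentiableOn (by simp) t ht), h0, map_zero]
  -- A return of the lift to its start would be a double point of the chord lying on the interval.
  ne_start t ht hne h0 := by
    have hz : (0 : ℝ) ∈ I01 := by simp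
    have he : D.chord 0 = D.chord t := by rw [h 0 hz, h t ht, h0]
    refine D.isGeneric.double_off_interval 0 hz t ht hne.symm he ?_
    exact ⟨D.start, ⟨D.start_pos.le, D.start_lt_one.le⟩, D.chord_zero.symm⟩

theorem IsIntervalDiffeo.convex_comb {f : ℝ → ℝ} (hf : IsIntervalDiffeo f) {s : ℝ}
    (hs : s ∈ I01) : IsIntervalDiffeo (fun x => (1 - s) * x + s * f x) where
  smooth := (contDiff_const.mul contDiff_id).contDiffOn.add (contDiffOn_const.mul hf.smooth)
  map_zero := by simp [hf.map_zero]
  map_one := by simp [hf.map_one]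
  deriv_pos x hx := by
    have h1 := (((hasDerivAt_id x).const_mul (1 - s)).hasDerivWithinAt (s := I01)).fun_add
      ((hf.smooth.differentiableOn (by simp) x hx).hasDerivWithinAt.const_mul s)
    simp only [id] at h1
    rw [h1.derivWithin (uniqueDiffOn_Icc zero_lt_one x hx)]
    have := hf.deriv_pos x hx
    obtain ⟨h0, h1⟩ := hs
    rcases h0.eq_or_lt with rfl | h0
    · simp
    · have := mul_pos h0 this
      linarith

theorem continuousOn_height_marked {f : ℝ → ℝ} (hf : IsIntervalDiffeo f) {x : ℝ} (h0 : 0 < x)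
    (h1 : x < 1) :
    ContinuousOn (fun s : ℝ => height (Real.pi * ((1 - s) * x + s * f x))) I01 := by
  have hpi := Real.pi_pos
  intro s hs
  obtain ⟨e0, e1⟩ := (hf.convex_comb hs).mem_Ioo h0 h1
  have hh := (contDiffAt_height (θ := Real.pi * ((1 - s) * x + s * f x)) (by positivity)
    (by nlinarith)).continuousAt
  have hg : ContinuousAt (fun s : ℝ => Real.pi * ((1 - s) * x + s * f x)) s := by fun_prop
  exact (ContinuousAt.comp (g := height)
    (f := fun s : ℝ => Real.pi * ((1 - s) * x + s * f x)) hh hg).continuousWithinAt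

/-- The interval moves by convex combinations of the identity and f, while the normalized lifts are
blended in the plane. Equality of the winding numbers makes the destinations lie over the same line
of longitude, so a single path Q can follow the destination. -/
theorem flatIsotopic_of_diffeo {D D' : LinearChordDiagram} {w : ℤ} (hw : HasWinding D w)
    (hw' : HasWinding D' w) {f : ℝ → ℝ} (hf : IsIntervalDiffeo f) (h0 : f D.start = D'.start)
    (h1 : f D.dest = D'.dest) : FlatIsotopic D D' := by
  have hpi := Real.pi_pos
  obtain ⟨K, v, k1, k2, k3, k4, k5, -⟩ := D.exists_lift
  obtain rfl := k5.unique hw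
  obtain ⟨K', v', k1', k2', k3', k4', k5', -⟩ := D'.exists_lift
  obtain rfl := k5'.unique hw'
  have hK := D.isLeavingArc k1 k2
  have hK' := D'.isLeavingArc k1' k2'
  have hu : UniqueDiffOn ℝ I01 := uniqueDiffOn_Icc zero_lt_one
  set φ : ℝ → ℝ → ℝ := fun s x => (1 - s) * x + s * f x
  set P : ℝ → ℂ := fun s => (height (Real.pi * φ s D.start) : ℂ) with hP
  set Q : ℝ → ℂ := fun s => (height (Real.pi * φ s D.dest) : ℂ)
    + (2 * Real.pi * v' : ℝ) * Complex.I with hQ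
  have hPc : ContinuousOn P I01 :=
    Complex.continuous_ofReal.comp_continuousOn
      (continuousOn_height_marked hf D.start_pos D.start_lt_one)
  have hQc : ContinuousOn Q I01 :=
    (Complex.continuous_ofReal.comp_continuousOn
      (continuousOn_height_marked hf D.dest_pos D.dest_lt_one)).add continuousOn_const
  -- The marked points stay in order, so the height of Q s exceeds that of P s.
  have hPQ : ∀ s ∈ I01, Q s - P s ≠ 0 := by
    intro s hs h
    have h2 := congrArg Complex.re h
    obtain ⟨a0, -⟩ := (hf.convex_comb hs).mem_Ioo D.start_pos D.start_lt_one
    obtain ⟨-, b1⟩ := (hf.convex_comb hs).mem_Ioo D.dest_pos D.dest_lt_one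
    have hlt := (hf.convex_comb hs).strictMonoOn (a := D.start) (b := D.dest)
      ⟨D.start_pos.le, D.start_lt_one.le⟩ ⟨D.dest_pos.le, D.dest_lt_one.le⟩ D.start_lt_dest
    have := height_lt_height (θ := Real.pi * φ s D.start) (θ' := Real.pi * φ s D.dest)
      (mul_pos hpi a0) (mul_lt_mul_of_pos_left hlt hpi)
      (by have := mul_lt_mul_of_pos_left b1 hpi; rwa [mul_one] at this)
    simp [hP, hQ] at h2
    linarith
  -- The affine map that takes 0 to P s and 1 to Q s places the normalized arcs over the marked
  -- points.
  set L : ℝ → ℝ → ℂ := fun s t => P s + (Q s - P s) * blend K K' s t with hL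
  have hLd : ∀ s ∈ I01, ∀ t ∈ I01,
      HasDerivWithinAt (L s) ((Q s - P s) * blendDer K K' s t) I01 t := fun s hs t ht =>
    ((hasDerivWithinAt_blend hK hK' hs ht).const_mul _).const_add _
  have hfst : Set.MapsTo (Prod.fst : ℝ × ℝ → ℝ) (I01 ×ˢ I01) I01 := fun z hz => hz.1
  have hPc2 : ContinuousOn (fun z : ℝ × ℝ => P z.1) (I01 ×ˢ I01) :=
    hPc.comp continuousOn_fst hfst
  have hQc2 : ContinuousOn (fun z : ℝ × ℝ => Q z.1) (I01 ×ˢ I01) :=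
    hQc.comp continuousOn_fst hfst
  have hLc : ContinuousOn (fun z : ℝ × ℝ => L z.1 z.2) (I01 ×ˢ I01) :=
    hPc2.add ((hQc2.sub hPc2).mul (continuousOn_blend hK hK'))
  have hLdc : ContinuousOn
      (fun z : ℝ × ℝ => (Q z.1 - P z.1) * blendDer K K' z.1 z.2) (I01 ×ˢ I01) :=
    (hQc2.sub hPc2).mul (continuousOn_blendDer hK hK')
  have hP0 : P 0 = K 0 := by rw [k3]; apply Complex.ext <;> simp [hP, φ]
  have hQ0 : Q 0 = K 1 := by rw [k4]; apply Complex.ext <;> simp [hQ, φ]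
  have hP1 : P 1 = K' 0 := by rw [k3']; apply Complex.ext <;> simp [hP, φ, h0]
  have hQ1 : Q 1 = K' 1 := by rw [k4']; apply Complex.ext <;> simp [hQ, φ, h1]
  refine ⟨φ, fun s t => merc (L s t), ?_, fun s hs => hf.convex_comb hs, by simp [φ],
    by simp [φ, h0], by simp [φ, h1], contDiff_merc.continuous.comp_continuousOn hLc,
    ?_, ?_, ?_, ?_, ?_⟩
  · have h2 : ContinuousOn (fun z : ℝ × ℝ => f z.2) (I01 ×ˢ I01) :=
      hf.smooth.continuousOn.comp continuousOn_snd fun z hz => hz.2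
    exact ContinuousOn.add (by fun_prop) (continuousOn_fst.mul h2)
  · have h2 : ContinuousOn (fun z : ℝ × ℝ => fderiv ℝ merc (L z.1 z.2)
        ((Q z.1 - P z.1) * blendDer K K' z.1 z.2)) (I01 ×ˢ I01) :=
      ((contDiff_merc.continuous_fderiv (by simp)).comp_continuousOn hLc).clm_apply hLdc
    refine h2.congr fun z hz => ?_
    have h3 := hLd z.1 hz.1 z.2 hz.2
    simp only [← h3.derivWithin (hu z.2 hz.2)]
    exact derivWithin_merc_comp hz.2 h3.differentiableWithinAt
  · intro s hs
    refine isImmersedArc_merc (contDiffOn_const.add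
      (contDiffOn_const.mul (contDiffOn_blend hK hK' hs))) fun t ht => ?_
    exact ((hLd s hs t ht).derivWithin (hu t ht)).symm ▸
      mul_ne_zero (hPQ s hs) (blendDer_ne_zero hK hK' hs ht)
  · intro s hs
    obtain ⟨a0, a1⟩ := (hf.convex_comb hs).mem_Ioo D.start_pos D.start_lt_one
    obtain ⟨b0, b1⟩ := (hf.convex_comb hs).mem_Ioo D.dest_pos D.dest_lt_one
    constructor
    · rw [interval_eq_merc a0 a1 0]
      simp only [hL, blend_at_zero]
      congr 1
      apply Complex.ext <;> simp [hP, φ]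
    · rw [interval_eq_merc b0 b1 v']
      simp only [hL, blend_at_one hK hK' hs]
      congr 1
      apply Complex.ext <;> simp [hQ, φ]
  · intro t ht
    have hne := hPQ 0 (by simp)
    simp only [hL, blend_zero hK', k2 t ht]
    rw [hP0, hQ0] at *
    rw [mul_div_cancel₀ _ hne]
    congr 1
    ring
  · intro t ht
    have hne := hPQ 1 (by simp)
    simp only [hL, blend_one hK, k2' t ht]
    rw [hP1, hQ1] at *
    rw [mul_div_cancel₀ _ hne]
    congr 1
    ring

/-! ### Diffeomorphisms of the interval moving two marked points -/

theorem IsIntervalDiffeo.comp {f g : ℝ → ℝ} (hg : IsIntervalDiffeo g) (hf : IsIntervalDiffeo f) :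
    IsIntervalDiffeo (fun x => g (f x)) := by
  have hm : Set.MapsTo f I01 I01 := fun x hx => by
    have h0 := hf.strictMonoOn.monotoneOn (a := 0) (by simp) hx hx.1
    have h1 := hf.strictMonoOn.monotoneOn (b := 1) hx (by simp) hx.2
    rw [hf.map_zero] at h0
    rw [hf.map_one] at h1
    exact ⟨h0, h1⟩
  refine ⟨hg.smooth.comp hf.smooth hm, by rw [hf.map_zero, hg.map_zero],
    by rw [hf.map_one, hg.map_one], fun x hx => ?_⟩
  have h := (hg.smooth.differentiableOn (by simp) _ (hm hx)).hasDerivWithinAt.scomp x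
    (hf.smooth.differentiableOn (by simp) x hx).hasDerivWithinAt hm
  have h' := h.derivWithin (uniqueDiffOn_Icc zero_lt_one x hx)
  change 0 < derivWithin (g ∘ f) I01 x
  rw [h', smul_eq_mul]
  exact mul_pos (hf.deriv_pos x hx) (hg.deriv_pos _ (hm hx))

theorem isIntervalDiffeo_of_hasDerivAt {f f' : ℝ → ℝ} (hf : ContDiffOn ℝ ∞ f I01) (h0 : f 0 = 0)
    (h1 : f 1 = 1) (hf' : ∀ x ∈ I01, HasDerivAt f (f' x) x) (hpos : ∀ x ∈ I01, 0 < f' x) :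
    IsIntervalDiffeo f :=
  ⟨hf, h0, h1, fun x hx => by
    rw [(hf' x hx).hasDerivWithinAt.derivWithin (uniqueDiffOn_Icc zero_lt_one x hx)]
    exact hpos x hx⟩

/-- The projective transformations of `[0,1]`. -/
def moebius (a x : ℝ) : ℝ := a * x / (1 - x + a * x)

theorem moebius_den_pos {a x : ℝ} (ha : 0 < a) (hx : x ∈ I01) : 0 < 1 - x + a * x := by
  obtain ⟨h0, h1⟩ := hx
  rcases h0.eq_or_lt with rfl | h0
  · simp
  · have := mul_pos ha h0
    linarith

theorem isIntervalDiffeo_moebius {a : ℝ} (ha : 0 < a) : IsIntervalDiffeo (moebius a) := by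
  refine isIntervalDiffeo_of_hasDerivAt (f' := fun x => a / (1 - x + a * x) ^ 2) ?_
    (by simp [moebius]) (by simp [moebius, ha.ne']) (fun x hx => ?_) fun x hx => ?_
  · exact ContDiffOn.div (by fun_prop) (by fun_prop) fun x hx => (moebius_den_pos ha hx).ne'
  · have hd := (moebius_den_pos ha hx).ne'
    have h1 : HasDerivAt (fun x : ℝ => a * x) a x := by
      simpa using (hasDerivAt_id x).const_mul a
    have h2 : HasDerivAt (fun x : ℝ => 1 - x + a * x) (-1 + a) x :=
      ((hasDerivAt_id x).const_sub 1).fun_add h1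
    refine (h1.fun_div h2 hd).congr_deriv ?_
    congr 1
    ring
  · have := moebius_den_pos ha hx
    positivity

theorem moebius_inv {a x : ℝ} (ha : 0 < a) (hx : x ∈ I01) : moebius a (moebius a⁻¹ x) = x := by
  have h1 := moebius_den_pos (inv_pos.2 ha) hx
  have h2 : 0 < a * (1 - x) + x := by
    have := mul_pos ha h1
    rw [mul_add, ← mul_assoc, mul_inv_cancel₀ ha.ne', one_mul] at this
    exact this
  have h3 : moebius a⁻¹ x = x / (a * (1 - x) + x) := by
    rw [moebius]; field_simp
  have h4 : 1 - x / (a * (1 - x) + x) + a * (x / (a * (1 - x) + x)) = a / (a * (1 - x) + x) := by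
    rw [eq_div_iff h2.ne', add_mul, sub_mul, mul_assoc a, div_mul_cancel₀ _ h2.ne']
    ring
  rw [h3, moebius, h4, ← mul_div_assoc, div_div_div_cancel_right₀ h2.ne',
    mul_div_cancel_left₀ _ ha.ne']

theorem exists_moebius_half {x : ℝ} (h0 : 0 < x) (h1 : x < 1) :
    ∃ a, 0 < a ∧ moebius a x = 1 / 2 := by
  have h2 : 0 < 1 - x := by linarith
  refine ⟨(1 - x) / x, by positivity, ?_⟩
  rw [moebius, div_mul_cancel₀ _ h0.ne']
  field_simp
  ring

/-- A family of diffeomorphisms of `[0,1]` symmetric about `1/2`. -/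
def spread (b x : ℝ) : ℝ :=
  (1 + b * (2 * x - 1) / Real.sqrt (1 - (2 * x - 1) ^ 2 + b ^ 2 * (2 * x - 1) ^ 2)) / 2

theorem spread_den_pos {b x : ℝ} (hb : 0 < b) (hx : x ∈ I01) :
    0 < 1 - (2 * x - 1) ^ 2 + b ^ 2 * (2 * x - 1) ^ 2 := by
  obtain ⟨h0, h1⟩ := hx
  have h2 : (2 * x - 1) ^ 2 ≤ 1 := by nlinarith
  rcases h2.eq_or_lt with h2 | h2
  · rw [h2]; have := pow_pos hb 2; linarith
  · have := mul_nonneg (sq_nonneg b) (sq_nonneg (2 * x - 1)); linarith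

theorem isIntervalDiffeo_spread {b : ℝ} (hb : 0 < b) : IsIntervalDiffeo (spread b) := by
  refine isIntervalDiffeo_of_hasDerivAt (f' := fun x =>
    b / (1 - (2 * x - 1) ^ 2 + b ^ 2 * (2 * x - 1) ^ 2) /
      Real.sqrt (1 - (2 * x - 1) ^ 2 + b ^ 2 * (2 * x - 1) ^ 2)) ?_ ?_ ?_ (fun x hx => ?_)
      fun x hx => ?_
  · have h1 : ContDiffOn ℝ ∞
        (fun x : ℝ => Real.sqrt (1 - (2 * x - 1) ^ 2 + b ^ 2 * (2 * x - 1) ^ 2)) I01 :=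
      ContDiffOn.sqrt (by fun_prop) fun x hx => (spread_den_pos hb hx).ne'
    have h2 : ContDiffOn ℝ ∞ (fun x : ℝ => b * (2 * x - 1)) I01 := by fun_prop
    exact (contDiffOn_const.add
      (h2.div h1 fun x hx => (Real.sqrt_pos.2 (spread_den_pos hb hx)).ne')).div_const 2
  · norm_num [spread, Real.sqrt_sq hb.le, hb.ne']
  · norm_num [spread, Real.sqrt_sq hb.le, hb.ne']
  · have hd := spread_den_pos hb hx
    have h1 : HasDerivAt (fun x : ℝ => 2 * x - 1) 2 x := by
      simpa using ((hasDerivAt_id x).const_mul 2).sub_const 1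
    have h2 : HasDerivAt (fun x : ℝ => 1 - (2 * x - 1) ^ 2 + b ^ 2 * (2 * x - 1) ^ 2)
        (-(2 * (2 * x - 1) * 2) + b ^ 2 * (2 * (2 * x - 1) * 2)) x := by
      have h3 := h1.fun_pow 2
      simp only [Nat.cast_ofNat, Nat.add_one_sub_one, pow_one] at h3
      exact (h3.const_sub 1).fun_add (h3.const_mul (b ^ 2))
    refine ((((h1.const_mul b).fun_div (h2.sqrt hd.ne')
      (Real.sqrt_pos.2 hd).ne').const_add 1).div_const 2).congr_deriv ?_
    have hr := Real.sqrt_pos.2 hd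
    have hrs := Real.sq_sqrt hd.le
    set r := Real.sqrt (1 - (2 * x - 1) ^ 2 + b ^ 2 * (2 * x - 1) ^ 2)
    rw [← hrs]
    field_simp
    linear_combination hrs
  · have := spread_den_pos hb hx
    have := Real.sqrt_pos.2 this
    positivity

/-- With e = 2x - 1, the map `spread b` is multiplication by b in the coordinate e / √(1 - e²) of
the open interval. Thus it fixes the midpoint, and a suitable b moves any point on its right to any
other. -/
theorem exists_diffeo_fixing_half {x y : ℝ} (hx : 1 / 2 < x) (hx1 : x < 1) (hy : 1 / 2 < y)
    (hy1 : y < 1) : ∃ f, IsIntervalDiffeo f ∧ f (1 / 2) = 1 / 2 ∧ f x = y := by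
  obtain ⟨e, he⟩ : ∃ e, e = 2 * x - 1 := ⟨_, rfl⟩
  obtain ⟨e', he'⟩ : ∃ e', e' = 2 * y - 1 := ⟨_, rfl⟩
  have e0 : 0 < e := by linarith
  have e0' : 0 < e' := by linarith
  have h1 : 0 < 1 - e ^ 2 := by nlinarith
  have h1' : 0 < 1 - e' ^ 2 := by nlinarith
  have hr := Real.sqrt_pos.2 h1
  have hr' := Real.sqrt_pos.2 h1'
  have hs := Real.sq_sqrt h1.le
  have hs' := Real.sq_sqrt h1'.le
  set r := Real.sqrt (1 - e ^ 2)
  set r' := Real.sqrt (1 - e' ^ 2)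
  -- The factor b is the quotient of the coordinates e'/r' of the target and e/r of the source.
  have hb : 0 < e' * r / (e * r') := by positivity
  refine ⟨_, isIntervalDiffeo_spread hb, by norm_num [spread], ?_⟩
  have h2 : 1 - e ^ 2 + (e' * r / (e * r')) ^ 2 * e ^ 2 = (r / r') ^ 2 := by
    rw [← hs]
    field_simp
    rw [hs']
    ring
  rw [spread, ← he, h2, Real.sqrt_sq (by positivity)]
  have h3 : e' * r / (e * r') * e / (r / r') = e' := by field_simp
  rw [h3, he']
  ring

/-- Projective maps bring p and p' to 1/2; it then remains to match the second points while fixing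
1/2. -/
theorem exists_diffeo {p q p' q' : ℝ} (hp : 0 < p) (hpq : p < q) (hq : q < 1) (hp' : 0 < p')
    (hpq' : p' < q') (hq' : q' < 1) : ∃ f, IsIntervalDiffeo f ∧ f p = p' ∧ f q = q' := by
  obtain ⟨a, ha, ea⟩ := exists_moebius_half hp (hpq.trans hq)
  obtain ⟨b, hb, eb⟩ := exists_moebius_half hp' (hpq'.trans hq')
  have hA := isIntervalDiffeo_moebius ha
  have hB := isIntervalDiffeo_moebius hb
  have h1 := hA.strictMonoOn ⟨hp.le, (hpq.trans hq).le⟩ ⟨(hp.trans hpq).le, hq.le⟩ hpq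
  have h2 := hB.strictMonoOn ⟨hp'.le, (hpq'.trans hq').le⟩ ⟨(hp'.trans hpq').le, hq'.le⟩ hpq'
  rw [ea] at h1
  rw [eb] at h2
  obtain ⟨f, hf, f1, f2⟩ := exists_diffeo_fixing_half h1 (hA.mem_Ioo (hp.trans hpq) hq).2 h2
    (hB.mem_Ioo (hp'.trans hpq') hq').2
  have hinv : ∀ x ∈ I01, moebius b⁻¹ (moebius b x) = x := fun x hx => by
    simpa using moebius_inv (inv_pos.2 hb) hx
  refine ⟨_, (isIntervalDiffeo_moebius (inv_pos.2 hb)).comp (hf.comp hA), ?_, ?_⟩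
  · simp only [ea, f1]
    rw [← eb]
    exact hinv _ ⟨hp'.le, (hpq'.trans hq').le⟩
  · simp only [f2]
    exact hinv _ ⟨(hp'.trans hpq').le, hq'.le⟩

/-! ### Completeness of the winding number and additivity under concatenation -/

theorem HasWinding.toA1l_eq {D D' : LinearChordDiagram} {w : ℤ} (h : HasWinding D w)
    (h' : HasWinding D' w) : D.toA1l = D'.toA1l := by
  obtain ⟨f, hf, h0, h1⟩ := exists_diffeo D.start_pos D.start_lt_dest D.dest_lt_one
    D'.start_pos D'.start_lt_dest D'.dest_lt_one
  exact Quot.sound (flatIsotopic_of_diffeo h h' hf h0 h1)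

theorem LinearChordDiagram.exists_hasWinding (D : LinearChordDiagram) : ∃ w, HasWinding D w := by
  obtain ⟨-, w, -, -, -, -, h, -⟩ := D.exists_lift
  exact ⟨w, h⟩

/-- A longitude along the chord of D restricts to longitudes along its three pieces, and the middle
piece contributes nothing. -/
theorem IsConcatenation.hasWinding {X Y D : LinearChordDiagram} (h : IsConcatenation X Y D)
    {v w : ℤ} (hX : HasWinding X v) (hY : HasWinding Y w) : HasWinding D (v + w) := by
  obtain ⟨-, -, -, t₁, t₂, h0, h12, h1, hx, hm, hy⟩ := h
  obtain ⟨u, θ, ⟨hθc, hθ⟩, hu⟩ := D.exists_hasWinding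
  have hd : 0 < 1 - t₂ := by linarith
  refine ⟨θ, ⟨hθc, hθ⟩, ?_⟩
  have mX : Set.MapsTo (fun t => t₁ * t) I01 I01 := fun t ht =>
    ⟨mul_nonneg h0.le ht.1, by nlinarith [ht.1, ht.2]⟩
  have mM : Set.MapsTo (fun t => t₁ + (t₂ - t₁) * t) I01 I01 := fun t ht =>
    ⟨by nlinarith [ht.1, ht.2], by nlinarith [ht.1, ht.2]⟩
  have mY : Set.MapsTo (fun t => t₂ + (1 - t₂) * t) I01 I01 := fun t ht =>
    ⟨by nlinarith [ht.1, ht.2], by nlinarith [ht.1, ht.2]⟩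
  have aX : IsAngle X.chord (fun t => θ (t₁ * t)) := by
    refine ⟨hθc.comp (by fun_prop) mX, fun t ht => ?_⟩
    have e := hx (t₁ * t) ⟨mul_nonneg h0.le ht.1, by nlinarith [ht.2]⟩
    rw [mul_div_cancel_left₀ _ h0.ne'] at e
    rw [← e]
    exact hθ _ (mX ht)
  have aY : IsAngle Y.chord (fun t => θ (t₂ + (1 - t₂) * t)) := by
    refine ⟨hθc.comp (by fun_prop) mY, fun t ht => ?_⟩
    have e := hy (t₂ + (1 - t₂) * t) ⟨by nlinarith [ht.1], by nlinarith [ht.2]⟩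
    rw [add_sub_cancel_left, mul_div_cancel_left₀ _ hd.ne'] at e
    rw [← e]
    exact hθ _ (mY ht)
  have e1 : D.chord t₁ = interval X.dest := by
    rw [hx t₁ ⟨h0.le, le_rfl⟩, div_self h0.ne', X.chord_one]
  have e2 : D.chord t₂ = interval Y.start := by
    rw [hy t₂ ⟨le_rfl, h1.le⟩, sub_self, zero_div, Y.chord_zero]
  have hpos : ∀ {x : ℝ}, 0 < x → x < 1 → 0 < interval x 0 := fun {x} a0 a1 => by
    have hpi := Real.pi_pos
    simpa [interval, sph] using
      Real.sin_pos_of_pos_of_lt_pi (x := Real.pi * x) (by positivity) (by nlinarith)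
  set c : ℝ → E3 := fun t => D.chord (t₁ + (t₂ - t₁) * t) with hc
  have hc0 : ∀ t ∈ I01, 0 < c t 0 := by
    intro t ht
    rcases ht.1.eq_or_lt with rfl | ht0
    · simp only [hc, mul_zero, add_zero, e1]
      exact hpos X.dest_pos X.dest_lt_one
    rcases ht.2.eq_or_lt with rfl | ht1
    · simp only [hc, mul_one, add_sub_cancel, e2]
      exact hpos Y.start_pos Y.start_lt_one
    · exact (hm _ ⟨by nlinarith, by nlinarith⟩).1
  have aM : IsAngle c (fun t => θ (t₁ + (t₂ - t₁) * t)) :=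
    ⟨hθc.comp (by fun_prop) mM, fun t ht => hθ _ (mM ht)⟩
  -- The first coordinate is positive on the connecting arc, ends included, so this is a continuous
  -- branch of the longitude. It vanishes at both ends because they lie on the interval.
  have aM' : IsAngle c (fun t => Real.arctan (c t 1 / c t 0)) := by
    constructor
    · have hcc : ContinuousOn c I01 :=
        D.isImmersedArc.smooth.continuousOn.comp (by fun_prop) mM
      have hi : ∀ i : Fin 3, ContinuousOn (fun t => c t i) I01 := fun i =>
        (EuclideanSpace.proj (𝕜 := ℝ) i).continuous.comp_continuousOn hcc
      exact Real.continuous_arctan.comp_continuousOn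
        ((hi 1).div (hi 0) fun t ht => (hc0 t ht).ne')
    · intro t ht
      have h := hc0 t ht
      have hs : 0 < Real.sqrt (1 + (c t 1 / c t 0) ^ 2) := Real.sqrt_pos.2 (by positivity)
      refine ⟨c t 0 * Real.sqrt (1 + (c t 1 / c t 0) ^ 2), by positivity, ?_, ?_⟩
      · rw [Real.cos_arctan]; field_simp
      · rw [Real.sin_arctan]; field_simp
  have sX := aX.sub_eq hX.choose_spec.1
  have sY := aY.sub_eq hY.choose_spec.1
  have sM := aM.sub_eq aM'
  rw [hX.choose_spec.2] at sX
  rw [hY.choose_spec.2] at sY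
  have z0 : c 0 1 = 0 := by simp [hc, e1, interval, sph]
  have z1 : c 1 1 = 0 := by simp [hc, e2, interval, sph]
  simp only [z0, z1, zero_div, sub_self, mul_one, mul_zero, add_zero, add_sub_cancel] at sX sY sM
  push_cast
  linarith

theorem hasWinding_windingDiagram : HasWinding windingDiagram 1 :=
  ⟨fun t => 2 * Real.pi * t, ⟨by fun_prop, fun _ ht => ⟨_, sin_polar_pos ht, rfl, rfl⟩⟩, by simp⟩

/-! ### Chords that are graphs of longitude over height -/

/-- The arc on the sphere which moves steadily from height `x₀` to height `x₁` of the Mercator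
chart, with longitude `ψ`. -/
def graphArc (x₀ x₁ : ℝ) (ψ : ℝ → ℝ) (t : ℝ) : E3 := merc ⟨x₀ + (x₁ - x₀) * t, ψ t⟩

theorem exists_eq_of_merc_mem_interval {z : ℂ} (h : merc z ∈ interval '' I01) :
    ∃ n : ℤ, z.im = 2 * Real.pi * n := by
  obtain ⟨x, ⟨h0, h1⟩, e⟩ := h
  have e0 : 0 < x := h0.lt_of_ne fun h => merc_ne_leg z (by rw [← e, ← h]; rfl)
  have e1 : x < 1 := h1.lt_of_ne fun h => merc_ne_head z (by rw [← e, h]; rfl)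
  obtain ⟨n, hn⟩ := eq_of_merc_eq_interval e0 e1 e.symm
  exact ⟨n, by rw [hn]⟩

theorem deriv_interval_ne_zero (x : ℝ) : deriv interval x ≠ 0 := by
  intro h
  rw [deriv_interval] at h
  have h0 := congrArg (fun v : E3 => v 0) h
  have h2 := congrArg (fun v : E3 => v 2) h
  simp [Real.pi_ne_zero] at h0 h2
  have := Real.sin_sq_add_cos_sq (Real.pi * x)
  rw [h0, h2] at this
  norm_num at this

theorem contDiffOn_graph {ψ : ℝ → ℝ} (hψ : ContDiff ℝ ∞ ψ) (x₀ x₁ : ℝ) :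
    ContDiffOn ℝ ∞ (fun t : ℝ => (⟨x₀ + (x₁ - x₀) * t, ψ t⟩ : ℂ)) I01 := by
  have h : ContDiff ℝ ∞ (fun t : ℝ => ((x₀ + (x₁ - x₀) * t : ℝ) : ℂ) + (ψ t : ℂ) * Complex.I) :=
    (Complex.ofRealCLM.contDiff.comp
      (contDiff_const.add (contDiff_const.mul contDiff_id))).add
      ((Complex.ofRealCLM.contDiff.comp hψ).mul contDiff_const)
  refine h.contDiffOn.congr fun t _ => ?_
  apply Complex.ext <;> simp

theorem isImmersedArc_graphArc {x₀ x₁ : ℝ} (hx : x₀ < x₁) {ψ : ℝ → ℝ} (hψ : ContDiff ℝ ∞ ψ) :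
    IsImmersedArc (graphArc x₀ x₁ ψ) := by
  have hK := contDiffOn_graph hψ x₀ x₁
  refine isImmersedArc_merc hK fun t ht h => ?_
  have hd := Complex.reCLM.hasFDerivAt.comp_hasDerivWithinAt t
    (hK.differentiableOn (by simp) t ht).hasDerivWithinAt
  rw [h, map_zero] at hd
  have hd' : HasDerivWithinAt (fun t : ℝ => x₀ + (x₁ - x₀) * t) (x₁ - x₀) I01 t := by
    simpa using ((((hasDerivAt_id t).const_mul (x₁ - x₀)).const_add x₀).hasDerivWithinAt (s := I01))
  have := (uniqueDiffOn_Icc zero_lt_one t ht).eq_deriv _ hd' hd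
  linarith

theorem graphArc_injective {x₀ x₁ : ℝ} (hx : x₀ < x₁) (ψ : ℝ → ℝ) : (graphArc x₀ x₁ ψ).Injective := by
  intro t u h
  have h1 : x₀ + (x₁ - x₀) * t = x₀ + (x₁ - x₀) * u := merc_re_eq h
  exact mul_left_cancel₀ (sub_pos.2 hx).ne' (add_left_cancel h1)

/-- Increasing height excludes self-crossings. Where the arc meets the interval, the second
coordinate of its velocity is a nonzero multiple of ψ', whereas that of the interval is zero; so
transversality means ψ' ≠ 0 at the longitudes in 2πℤ. -/
theorem isGeneric_graphArc {x₀ x₁ : ℝ} (hx : x₀ < x₁) {ψ : ℝ → ℝ} (hψ : ContDiff ℝ ∞ ψ)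
    (hcross : ∀ t ∈ I01, ∀ n : ℤ, ψ t = 2 * Real.pi * n → deriv ψ t ≠ 0) :
    IsGeneric (graphArc x₀ x₁ ψ) where
  self_transverse _ _ _ _ hne h := absurd (graphArc_injective hx ψ h) hne
  no_triple _ _ _ _ _ _ h _ := Or.inl (graphArc_injective hx ψ h)
  double_off_interval _ _ _ _ hne h := absurd (graphArc_injective hx ψ h) hne
  interval_transverse := by
    intro t ht x hx' h
    obtain ⟨n, hn⟩ := exists_eq_of_merc_mem_interval (z := ⟨x₀ + (x₁ - x₀) * t, ψ t⟩)
      ⟨x, hx', h.symm⟩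
    have hd' : HasDerivAt (fun t : ℝ => x₀ + (x₁ - x₀) * t) (x₁ - x₀) t := by
      simpa using ((hasDerivAt_id t).const_mul (x₁ - x₀)).const_add x₀
    have hp := HasDerivAt.comp (h₂ := polar) t (hasDerivAt_polar (x₀ + (x₁ - x₀) * t)) hd'
    have hD := hasDerivAt_sph hp (hψ.differentiable (by simp) t).hasDerivAt
    have hD' := hD.hasDerivWithinAt.derivWithin (uniqueDiffOn_Icc zero_lt_one t ht)
    change derivWithin (graphArc x₀ x₁ ψ) I01 t = _ at hD'
    have hc : Real.cos (ψ t) = 1 := by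
      rw [show ψ t = n * (2 * Real.pi) by rw [mul_comm]; exact hn]
      exact Real.cos_int_mul_two_pi n
    have hs : Real.sin (ψ t) = 0 := by
      rw [Real.sin_eq_zero_iff]; exact ⟨2 * n, by push_cast; linarith⟩
    have hsp := (sin_polar (x₀ + (x₁ - x₀) * t)).ne'
    have hψ' := hcross t ht n hn
    rw [LinearIndependent.pair_iff]
    intro a b hab
    have h1 := congrArg (fun v : E3 => v 1) hab
    rw [hD', deriv_interval] at h1
    have ha : a = 0 := by
      simpa [hs, hc, hsp, hψ'] using h1
    refine ⟨ha, ?_⟩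
    rw [ha, zero_smul, zero_add] at hab
    exact (smul_eq_zero.1 hab).resolve_right (deriv_interval_ne_zero x)

theorem interval_polar (x : ℝ) (n : ℤ) :
    interval (polar x / Real.pi) = merc ⟨x, 2 * Real.pi * n⟩ := by
  have hpi := Real.pi_pos
  rw [interval_eq_merc (div_pos (polar_pos x) hpi) ((div_lt_one hpi).2 (polar_lt_pi x)) n,
    mul_div_cancel₀ _ hpi.ne', height_polar]

/-- The diagram whose chord is the arc `graphArc x₀ x₁ ψ`. -/
def graphDiagram {x₀ x₁ : ℝ} (hx : x₀ < x₁) {ψ : ℝ → ℝ} (hψ : ContDiff ℝ ∞ ψ)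
    (hcross : ∀ t ∈ I01, ∀ n : ℤ, ψ t = 2 * Real.pi * n → deriv ψ t ≠ 0) {m n : ℤ}
    (h0 : ψ 0 = 2 * Real.pi * m) (h1 : ψ 1 = 2 * Real.pi * n) : LinearChordDiagram where
  start := polar x₀ / Real.pi
  dest := polar x₁ / Real.pi
  start_pos := div_pos (polar_pos _) Real.pi_pos
  start_lt_dest := div_lt_div_of_pos_right (polar_strictMono hx) Real.pi_pos
  dest_lt_one := (div_lt_one Real.pi_pos).2 (polar_lt_pi _)
  chord := graphArc x₀ x₁ ψ
  isImmersedArc := isImmersedArc_graphArc hx hψ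
  isGeneric := isGeneric_graphArc hx hψ hcross
  chord_zero := by rw [interval_polar x₀ m, graphArc, h0]; simp
  chord_one := by rw [interval_polar x₁ n, graphArc, h1]; simp

theorem hasWinding_graphDiagram {x₀ x₁ : ℝ} (hx : x₀ < x₁) {ψ : ℝ → ℝ} (hψ : ContDiff ℝ ∞ ψ)
    (hcross : ∀ t ∈ I01, ∀ n : ℤ, ψ t = 2 * Real.pi * n → deriv ψ t ≠ 0) {m n : ℤ}
    (h0 : ψ 0 = 2 * Real.pi * m) (h1 : ψ 1 = 2 * Real.pi * n) :
    HasWinding (graphDiagram hx hψ hcross h0 h1) (n - m) :=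
  ⟨ψ, isAngle_of_merc (K := fun t => ⟨x₀ + (x₁ - x₀) * t, ψ t⟩)
    (contDiffOn_graph hψ x₀ x₁).continuousOn fun _ _ => rfl, by
    rw [h0, h1]; push_cast; ring⟩

/-! ### Explicit concatenations with prescribed winding numbers -/

/-- A quadratic polynomial with a simple zero at `0` and value `-2πw` at `-1`. -/
def turn (w : ℤ) (u : ℝ) : ℝ := u * (1 + (1 - 2 * Real.pi * w) * u)

theorem contDiff_turn (w : ℤ) : ContDiff ℝ ∞ (turn w) := by unfold turn; fun_prop

theorem turn_zero (w : ℤ) : turn w 0 = 0 := by simp [turn]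

theorem turn_neg_one (w : ℤ) : turn w (-1) = -(2 * Real.pi * w) := by unfold turn; ring

theorem hasDerivAt_turn (w : ℤ) (u : ℝ) :
    HasDerivAt (turn w) (1 + 2 * (1 - 2 * Real.pi * w) * u) u := by
  have h := (hasDerivAt_id u).fun_mul (((hasDerivAt_id u).const_mul
    (1 - 2 * Real.pi * w)).const_add 1)
  refine h.congr_deriv ?_
  simp only [id]
  ring

/-- Put k = 1 - 2πw. At a critical point 2ku = -1, so the value is u/2, and |k| ≥ 1 gives |u| ≤ 1/2.
If the value is 2πn, then u = 4πn forces n = 0 and u = 0, where the derivative is 1. -/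
theorem deriv_turn_ne_zero (w : ℤ) {u : ℝ} {n : ℤ} (h : turn w u = 2 * Real.pi * n) :
    1 + 2 * (1 - 2 * Real.pi * w) * u ≠ 0 := by
  intro hd
  have hpi := Real.pi_gt_three
  have hk : 1 ≤ |1 - 2 * Real.pi * w| := by
    rcases lt_trichotomy w 0 with hw | rfl | hw
    · have : (w : ℝ) ≤ -1 := by exact_mod_cast Int.le_sub_one_of_lt hw
      rw [le_abs]; left; nlinarith
    · simp
    · have : (1 : ℝ) ≤ w := by exact_mod_cast hw
      rw [le_abs]; right; nlinarith
  have h1 : turn w u = u / 2 := by unfold turn; linear_combination (u / 2) * hd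
  have h2 : |1 - 2 * Real.pi * w| * |u| = 1 / 2 := by
    rw [← abs_mul, show (1 - 2 * Real.pi * w) * u = -(1 / 2) by linear_combination hd / 2]
    norm_num
  have h3 : |u| ≤ 1 / 2 := by nlinarith [abs_nonneg u]
  have h4 : u = 4 * Real.pi * n := by linarith
  have hn : n = 0 := by
    by_contra hn
    have : (1 : ℝ) ≤ |(n : ℝ)| := by exact_mod_cast Int.one_le_abs hn
    rw [h4, abs_mul, abs_of_pos (by positivity)] at h3
    nlinarith
  rw [hn] at h4
  simp [h4] at hd

theorem turn_mem_Ioo (w : ℤ) {u : ℝ} (h0 : 0 < u) (h1 : u ≤ 1 / 2)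
    (h2 : |1 - 2 * Real.pi * w| * u ≤ 1 / 2) : 0 < turn w u ∧ turn w u < 1 := by
  have h3 : |(1 - 2 * Real.pi * w) * u| ≤ 1 / 2 := by rwa [abs_mul, abs_of_pos h0]
  obtain ⟨h4, h5⟩ := abs_le.1 h3
  unfold turn
  exact ⟨mul_pos h0 (by linarith), by nlinarith⟩

theorem deriv_eq_of_eqOn_Icc {f g : ℝ → ℝ} {a b t : ℝ} (hab : a < b)
    (hf : DifferentiableAt ℝ f t) (hg : DifferentiableAt ℝ g t) (h : Set.EqOn f g (Set.Icc a b))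
    (ht : t ∈ Set.Icc a b) : deriv f t = deriv g t := by
  have hu := uniqueDiffOn_Icc hab t ht
  rw [← hf.derivWithin hu, ← hg.derivWithin hu, derivWithin_congr h (h ht)]

/-- The longitude follows A from 0 to 2πv on [0,r] and B from 2πv to 2π(v+w) on [1-r,1]. Both
polynomials are slightly above 2πv inside the gap, so interpolating there keeps the connecting arc
off the interval. -/
theorem exists_isConcatenation (v w : ℤ) :
    ∃ X Y D : LinearChordDiagram, HasWinding X v ∧ HasWinding Y w ∧ IsConcatenation X Y D := by
  -- The gap (r, 1-r) has length 2η and r > 1/4, so the arguments of `turn` in the gap are at most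
  -- 8η. The constant 16 makes 8η and its products with both leading coefficients at most 1/2, as
  -- `turn_mem_Ioo` requires.
  obtain ⟨η, hη⟩ : ∃ η : ℝ, η = 1 / (16 * (1 + |1 - 2 * Real.pi * (v : ℝ)|
    + |1 - 2 * Real.pi * ((-w : ℤ) : ℝ)|)) := ⟨_, rfl⟩
  have kv := abs_nonneg (1 - 2 * Real.pi * (v : ℝ))
  have kw := abs_nonneg (1 - 2 * Real.pi * ((-w : ℤ) : ℝ))
  have η0 : 0 < η := by rw [hη]; positivity
  have hη' : η * (16 * (1 + |1 - 2 * Real.pi * (v : ℝ)|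
      + |1 - 2 * Real.pi * ((-w : ℤ) : ℝ)|)) = 1 := by
    rw [hη]; exact one_div_mul_cancel (by positivity)
  have pv := mul_nonneg η0.le kv
  have pw := mul_nonneg η0.le kw
  have η1 : η ≤ 1 / 16 := by nlinarith
  obtain ⟨r, hr⟩ : ∃ r : ℝ, r = 1 / 2 - η := ⟨_, rfl⟩
  have r0 : 1 / 4 < r := by linarith
  have rpos : 0 < r := by linarith
  have r2 : r < 1 - r := by linarith
  set A : ℝ → ℝ := fun t => 2 * Real.pi * v + turn v (t / r - 1) with hA
  -- B runs `turn` backwards in time, hence the parameter -w: the value at time 1 is 2πv + 2πw, and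
  -- the longitude comes down to 2πv from above at time 1 - r.
  set B : ℝ → ℝ := fun t => 2 * Real.pi * v + turn (-w) ((1 - r - t) / r) with hB
  set χ : ℝ → ℝ := fun t => Real.smoothTransition ((t - r) / (1 - r - r)) with hχ
  set ψ : ℝ → ℝ := fun t => (1 - χ t) * A t + χ t * B t with hψ
  have sA : ContDiff ℝ ∞ A := contDiff_const.add ((contDiff_turn v).comp (by fun_prop))
  have sB : ContDiff ℝ ∞ B := contDiff_const.add ((contDiff_turn (-w)).comp (by fun_prop))
  have sχ : ContDiff ℝ ∞ χ := Real.smoothTransition.contDiff.comp (by fun_prop)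
  have sψ : ContDiff ℝ ∞ ψ := ((contDiff_const.sub sχ).mul sA).add (sχ.mul sB)
  have dA : ∀ t, deriv A t = (1 + 2 * (1 - 2 * Real.pi * v) * (t / r - 1)) * (1 / r) := fun t =>
    (((hasDerivAt_turn v (t / r - 1)).comp t
      (((hasDerivAt_id t).div_const r).sub_const 1)).const_add _).deriv
  have dB : ∀ t, deriv B t =
      (1 + 2 * (1 - 2 * Real.pi * (-w : ℤ)) * ((1 - r - t) / r)) * (-1 / r) := fun t =>
    (HasDerivAt.const_add _ ((hasDerivAt_turn (-w) ((1 - r - t) / r)).comp t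
      (((hasDerivAt_id t).const_sub (1 - r)).div_const r))).deriv
  have cA : ∀ t, ∀ n : ℤ, A t = 2 * Real.pi * n → deriv A t ≠ 0 := fun t n h => by
    rw [dA]
    refine mul_ne_zero (deriv_turn_ne_zero v (n := n - v) ?_) (by positivity)
    push_cast
    simp only [hA] at h
    linarith
  have cB : ∀ t, ∀ n : ℤ, B t = 2 * Real.pi * n → deriv B t ≠ 0 := fun t n h => by
    rw [dB]
    refine mul_ne_zero (deriv_turn_ne_zero (-w) (n := n - v) ?_)
      (div_ne_zero (by norm_num) rpos.ne')
    rw [Int.cast_sub]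
    simp only [hB] at h
    linarith
  have eA : ∀ t, t ≤ r → ψ t = A t := fun t ht => by
    have : χ t = 0 := Real.smoothTransition.zero_of_nonpos
      (div_nonpos_of_nonpos_of_nonneg (by linarith) (by linarith))
    simp [hψ, this]
  have eB : ∀ t, 1 - r ≤ t → ψ t = B t := fun t ht => by
    have : χ t = 1 := Real.smoothTransition.one_of_one_le
      ((one_le_div (by linarith)).2 (by linarith))
    simp [hψ, this]
  have small : ∀ u : ℝ, 0 < u → u < 2 * η → 0 < u / r ∧ u / r ≤ 8 * η := fun u h0 h1 =>
    ⟨by positivity, by rw [div_le_iff₀ rpos]; nlinarith⟩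
  have mid : ∀ t ∈ Set.Ioo r (1 - r), 0 < ψ t - 2 * Real.pi * v ∧ ψ t - 2 * Real.pi * v < 1 := by
    intro t ht
    obtain ⟨u0, u1⟩ := small (t - r) (by linarith [ht.1]) (by linarith [ht.2])
    obtain ⟨y0, y1⟩ := small (1 - r - t) (by linarith [ht.2]) (by linarith [ht.1])
    have e : t / r - 1 = (t - r) / r := by field_simp
    obtain ⟨a0, a1⟩ := turn_mem_Ioo v u0 (by linarith) (by nlinarith)
    obtain ⟨b0, b1⟩ := turn_mem_Ioo (-w) y0 (by linarith) (by nlinarith)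
    have c0 : 0 ≤ χ t := Real.smoothTransition.nonneg _
    have c1 : χ t ≤ 1 := Real.smoothTransition.le_one _
    have e2 : ψ t - 2 * Real.pi * v =
        (1 - χ t) * turn v ((t - r) / r) + χ t * turn (-w) ((1 - r - t) / r) := by
      simp only [hψ, hA, hB, e]; ring
    rw [e2]
    rcases c0.eq_or_lt with c | c
    · rw [← c]; constructor <;> linarith
    · constructor
      · have := mul_nonneg (sub_nonneg.2 c1) a0.le
        have := mul_pos c b0
        linarith
      · have := mul_le_mul_of_nonneg_left a1.le (sub_nonneg.2 c1)
        have := mul_lt_mul_of_pos_left b1 c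
        linarith
  -- No multiple of 2π lies strictly between 2πv and 2πv + 1.
  have midn : ∀ t ∈ Set.Ioo r (1 - r), ∀ n : ℤ, ψ t ≠ 2 * Real.pi * n := by
    intro t ht n h
    obtain ⟨m0, m1⟩ := mid t ht
    have hpi := Real.pi_gt_three
    have e : ψ t - 2 * Real.pi * v = 2 * Real.pi * ((n - v : ℤ) : ℝ) := by
      rw [h]; push_cast; ring
    rw [e] at m0 m1
    have : (0 : ℝ) < ((n - v : ℤ) : ℝ) := pos_of_mul_pos_right m0 (by positivity)
    have : (1 : ℝ) ≤ ((n - v : ℤ) : ℝ) := by exact_mod_cast this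
    nlinarith
  have cψ : ∀ t ∈ I01, ∀ n : ℤ, ψ t = 2 * Real.pi * n → deriv ψ t ≠ 0 := by
    intro t ht n h
    have dψ := sψ.differentiable (by simp) t
    rcases le_or_gt t r with h1 | h1
    · rw [deriv_eq_of_eqOn_Icc rpos dψ (sA.differentiable (by simp) t) (fun u hu => eA u hu.2)
        ⟨ht.1, h1⟩]
      exact cA t n ((eA t h1).symm.trans h)
    rcases le_or_gt (1 - r) t with h2 | h2
    · rw [deriv_eq_of_eqOn_Icc (show 1 - r < 1 by linarith) dψ (sB.differentiable (by simp) t)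
        (fun u hu => eB u hu.1) ⟨h2, ht.2⟩]
      exact cB t n ((eB t h2).symm.trans h)
    · exact absurd h (midn t ⟨h1, h2⟩ n)
  have A0 : A 0 = 2 * Real.pi * (0 : ℤ) := by simp [hA, turn_neg_one]
  have Ar : A r = 2 * Real.pi * v := by simp [hA, turn_zero, rpos.ne']
  have Br : B (1 - r) = 2 * Real.pi * v := by simp [hB, turn_zero]
  have B1 : B 1 = 2 * Real.pi * (v + w : ℤ) := by
    have : (1 - r - 1) / r = -1 := by field_simp; ring
    simp only [hB, this, turn_neg_one]
    push_cast
    ring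
  have comp_deriv : ∀ {f : ℝ → ℝ}, ContDiff ℝ ∞ f → ∀ a b t : ℝ,
      deriv (fun t => f (a + b * t)) t = deriv f (a + b * t) * b := fun {f} hf a b t => by
    have h1 : HasDerivAt (fun t : ℝ => a + b * t) b t := by
      simpa using ((hasDerivAt_id t).const_mul b).const_add a
    exact (HasDerivAt.comp (h₂ := f) t (hf.differentiable (by simp) _).hasDerivAt h1).deriv
  have cX : ∀ t ∈ I01, ∀ n : ℤ, A (0 + r * t) = 2 * Real.pi * n →
      deriv (fun t => A (0 + r * t)) t ≠ 0 := fun t _ n h => by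
    rw [comp_deriv sA]
    exact mul_ne_zero (cA _ n h) rpos.ne'
  have cY : ∀ t ∈ I01, ∀ n : ℤ, B (1 - r + r * t) = 2 * Real.pi * n →
      deriv (fun t => B (1 - r + r * t)) t ≠ 0 := fun t _ n h => by
    rw [comp_deriv sB]
    exact mul_ne_zero (cB _ n h) rpos.ne'
  have sX : ContDiff ℝ ∞ fun t => A (0 + r * t) := sA.comp (by fun_prop)
  have sY : ContDiff ℝ ∞ fun t => B (1 - r + r * t) := sB.comp (by fun_prop)
  have X0 : A (0 + r * 0) = 2 * Real.pi * (0 : ℤ) := by simpa using A0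
  have X1 : A (0 + r * 1) = 2 * Real.pi * v := by simpa using Ar
  have Y0 : B (1 - r + r * 0) = 2 * Real.pi * v := by simpa using Br
  have Y1 : B (1 - r + r * 1) = 2 * Real.pi * (v + w : ℤ) := by simpa using B1
  have hr1 : 1 - r < 1 := by linarith
  refine ⟨graphDiagram rpos sX cX X0 X1, graphDiagram hr1 sY cY Y0 Y1,
    graphDiagram zero_lt_one sψ cψ ((eA 0 rpos.le).trans A0) ((eB 1 (by linarith)).trans B1),
    ?_, ?_, ?_⟩
  · simpa using hasWinding_graphDiagram rpos sX cX X0 X1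
  · simpa using hasWinding_graphDiagram hr1 sY cY Y0 Y1
  · refine ⟨div_lt_div_of_pos_right (polar_strictMono r2) Real.pi_pos, rfl, rfl, r, 1 - r, rpos,
      r2, by linarith, ?_, ?_, ?_⟩
    · intro t ht
      have e : r * (t / r) = t := by field_simp
      simp [graphDiagram, graphArc, e, eA t ht.2]
    · intro t ht
      obtain ⟨m0, m1⟩ := mid t ht
      refine ⟨mul_pos (sin_polar _) ?_, fun h => ?_⟩
      · have h1 : Real.cos (ψ t - v * (2 * Real.pi)) = Real.cos (ψ t) :=
          Real.cos_sub_int_mul_two_pi _ v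
        change 0 < Real.cos (ψ t)
        have hpi := Real.pi_gt_three
        rw [← h1]
        exact Real.cos_pos_of_mem_Ioo ⟨by linarith, by linarith⟩
      · obtain ⟨n, hn⟩ := exists_eq_of_merc_mem_interval h
        exact midn t ht n hn
    · intro t ht
      have e : r * ((t - (1 - r)) / r) = t - (1 - r) := by field_simp
      simp [graphDiagram, graphArc, e, eB t ht.1]

/-! ### The bijection with the integers and the group structure -/

/-- The winding number of a class around the leg. -/
def winding : A1l → ℤ :=
  Quot.lift (fun D => D.exists_hasWinding.choose) fun D D' h =>
    (h.hasWinding D.exists_hasWinding.choose_spec).unique D'.exists_hasWinding.choose_spec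

theorem HasWinding.winding_eq {D : LinearChordDiagram} {w : ℤ} (h : HasWinding D w) :
    winding D.toA1l = w :=
  D.exists_hasWinding.choose_spec.unique h

theorem winding_injective : Function.Injective winding := by
  rintro ⟨D⟩ ⟨D'⟩ h
  obtain ⟨w, hw⟩ := D.exists_hasWinding
  obtain ⟨w', hw'⟩ := D'.exists_hasWinding
  have : w = w' := hw.winding_eq.symm.trans (h.trans hw'.winding_eq)
  subst this
  exact hw.toA1l_eq hw'

theorem winding_surjective : Function.Surjective winding := fun w => by
  obtain ⟨X, -, -, h, -, -⟩ := exists_isConcatenation w 0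
  exact ⟨_, h.winding_eq⟩

/-- The classes of diagrams correspond to the integers. -/
def windingEquiv : A1l ≃ Multiplicative ℤ :=
  (Equiv.ofBijective winding ⟨winding_injective, winding_surjective⟩).trans Multiplicative.ofAdd

end

end Knotoid

theorem mainTheorem4 :
    ∃ _ : Group Knotoid.A1l,
      (∀ X Y D : Knotoid.LinearChordDiagram, Knotoid.IsConcatenation X Y D →
        D.toA1l = X.toA1l * Y.toA1l) ∧
      (∀ x y : Knotoid.A1l, ∃ X Y D : Knotoid.LinearChordDiagram,
        X.toA1l = x ∧ Y.toA1l = y ∧ Knotoid.IsConcatenation X Y D) ∧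
      (∀ C : Knotoid.A1l, ∃! w : ℤ, C = Knotoid.a ^ w) ∧
      IsCyclic Knotoid.A1l ∧ Infinite Knotoid.A1l := by
  -- The multiplication is transported from ℤ; additivity of winding numbers then identifies it with
  -- concatenation.
  let _ : Group Knotoid.A1l := Knotoid.windingEquiv.group
  let e : Knotoid.A1l ≃* Multiplicative ℤ := Knotoid.windingEquiv.mulEquiv
  have he : ∀ {D w}, Knotoid.HasWinding D w → e D.toA1l = Multiplicative.ofAdd w :=
    fun h => congrArg Multiplicative.ofAdd h.winding_eq
  have ha : e Knotoid.a = Multiplicative.ofAdd 1 := he Knotoid.hasWinding_windingDiagram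
  refine ⟨inferInstance, fun X Y D h => ?_, fun x y => ?_, fun C => ?_, ?_, ?_⟩
  · obtain ⟨v, hv⟩ := X.exists_hasWinding
    obtain ⟨w, hw⟩ := Y.exists_hasWinding
    apply e.injective
    rw [map_mul, he hv, he hw, he (h.hasWinding hv hw), ofAdd_add]
  · obtain ⟨X, Y, D, hX, hY, h⟩ :=
      Knotoid.exists_isConcatenation (Knotoid.winding x) (Knotoid.winding y)
    exact ⟨X, Y, D, Knotoid.winding_injective hX.winding_eq,
      Knotoid.winding_injective hY.winding_eq, h⟩
  -- As `a` corresponds to 1, its power with exponent w corresponds to w, which gives existence and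
  -- uniqueness at once.
  · have key : ∀ w : ℤ, C = Knotoid.a ^ w ↔ w = Multiplicative.toAdd (e C) := fun w => by
      rw [← e.injective.eq_iff, map_zpow, ha, ← ofAdd_zsmul, smul_eq_mul, mul_one]
      exact ⟨fun h => by rw [h]; rfl, fun h => by rw [h]; rfl⟩
    exact ⟨_, (key _).2 rfl, fun w h => (key w).1 h⟩
  · exact isCyclic_of_surjective e.symm e.symm.surjective
  · exact Infinite.of_injective e.symm e.symm.injective
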